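/- **Setting.** A system $M=\langle\Sigma,T,\tilde s\rangle$ consists of a set $\Sigma$ of states, a set $T$ of transitions (partial functions $\Sigma\to\Sigma$) and an initial state $\tilde s$. The set $\mathrm{reach}(M)$ of reachable states is finite, and each reachable state enables finitely many transitions. Let $I\subseteq T\times T$ be an unconditional independence relation: symmetric, irreflexive, and such that any $t\mathrel I t'$ commute at every reachable state $s$ (if $s\xrightarrow{t}s'$, then $t'$ is enabled at $s$ iff it is enabled at $s'$; if both are enabled at $s$, then $s\xrightarrow{t.t'}s'$ and $s\xrightarrow{t'.t}s'$ for some $s'$). Otherwise $t,t'$ are dependent. **Unfolding.** The events of the unfolding $\mathcal U$ of $M$ under $I$ are $\bot$ (with empty label) and all pairs $e=\langle t,H\rangle$ (with label $t$ and set of causes $\lceil e\rceil=H$), built inductively, where $H\ni\bot$ is a configuration of events already built, $t$ is enabled at $\mathrm{state}(H)$, and $H=\{\bot\}$ or all maximal events of $H$ have a label dependent with $t$. Put $[e]=\lceil e\rceil\cup\{e\}$. Conflict $\#$ is the least symmetric relation, inherited along causality, with $e\mathrel\# e'$ whenever $e\notin[e']$, $e'\notin[e]$ and the labels are dependent. A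 configuration is a finite, causally closed, conflict-free set $C$ of events; $\mathrm{state}(C)$ is the state reached by firing the labels of $C$ in any order compatible with causality. Write $e\mathrel{\#^i}e'$ iff $e\mathrel\# e'$ and both $\lceil e\rceil\cup[e']$ and $[e]\cup\lceil e'\rceil$ are configurations; $\mathrm{ex}(C)=\{e\notin C:\lceil e\rceil\subseteq C\}$; $\mathrm{en}(C)=\{e\in\mathrm{ex}(C):C\cup\{e\}\text{ is a configuration}\}$. The unfolding may be infinite. **Adequate orders.** An adequate order $\prec$ is a well-founded strict partial order on configurations that refines $\subsetneq$ and is preserved by finite extensions: if $C_1\prec C_2$, $\mathrm{state}(C_1)=\mathrm{state}(C_2)$, and $E_1,E_2$, isomorphic as labelled partial orders, are disjoint from $C_1,C_2$ respectively with $C_1\cup E_1,C_2\cup E_2$ configurations, then $C_1\cup E_1\prec C_2\cup E_2$. **Algorithm.** The global variables are $U$ and $G$, initially $\{\bot\}$ and $\emptyset$; any elements of $G$ may be discarded at any time. An event $e$ is *cutoff* w.r.t. the current $U,G$ iff some $e'\in U\cup G$ has $\mathrm{state}([e'])=\mathrm{state}([e])$ and $[e']\prec[e]$. An *alternative* to $D$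 after $C$ is a configuration $J\subseteq U$ such that $C\cup J$ is a configuration and every $e\in D$ has some $e'\in(C\cup J)\cap U$ with $e\mathrel{\#^i}e'$. The algorithm calls $\mathrm{Explore}(\{\bot\},\emptyset,\emptyset)$, where $\mathrm{Explore}(C,D,A)$ does the following: 1. add to $U$ every $e\in\mathrm{ex}(C)$ that is not cutoff when it is checked; 2. if $\mathrm{en}(C)\cap U=\emptyset$, return; 3. choose $e\in\mathrm{en}(C)\cap U$, with $e\in A$ if $A\ne\emptyset$; 4. call $\mathrm{Explore}(C\cup\{e\},D,A\setminus\{e\})$; 5. if there is an alternative to $D\cup\{e\}$ after $C$, choose one, $J$, and call $\mathrm{Explore}(C,D\cup\{e\},J\setminus C)$; 6. move from $U$ to $G$ the elements of $(\{e\}\cup\bigcup_{\hat e\in U,\,\hat e\#^i e}[\hat e])\setminus Q$, where $Q=C\cup D\cup\bigcup_{e_1\in C\cup D,\,e_2\in U,\,e_1\#^i e_2}[e_2]$. **Theorem (Completeness with cutoffs).** For every adequate order $\prec$ (in particular for the size order $C\prec C'\iff|C|<|C'|$, which is adequate) and every reachable state $s\in\mathrm{reach}(M)$, every execution of the algorithm,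 whatever its choices, calls $\mathrm{Explore}(C,D,A)$ (for some $D,A$) with a configuration $C$ that has a subconfiguration $C'\subseteq C$ with $\mathrm{state}(C')=s$. -/

import Mathlib

universe u v

namespace PartialOrderUnfolding

/-! ### Systems, runs and independence -/

/-- A system: a type `S` of global states, a type `T` of transitions, an initial state, and for
every transition a partial function on states (`fire t s = none`: `t` is not enabled at `s`). -/
structure System (S : Type v) (T : Type u) where
  /-- the initial global state -/
  init : S
  /-- the partial function of a transition -/
  fire : T → S → Option S

variable {S : Type v} {T : Type u}

/-- `M.run s σ` is the state reached by firing the sequence `σ` from `s`, if this is possible. -/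
def System.run (M : System S T) : S → List T → Option S
  | s, [] => some s
  | s, t :: σ => (M.fire t s).bind fun s' => M.run s' σ

/-- The transitions enabled at a state. -/
def System.enabled (M : System S T) (s : S) : Set T :=
  {t | ∃ s', M.fire t s = some s'}

/-- The reachable states. -/
def System.reach (M : System S T) : Set S :=
  {s | ∃ σ : List T, M.run M.init σ = some s}

/-- The transitions `t` and `t'` commute at the state `s`. -/
def System.CommuteAt (M : System S T) (t t' : T) (s : S) : Prop :=
  (∀ s', M.fire t s = some s' → (t' ∈ M.enabled s ↔ t' ∈ M.enabled s')) ∧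
  (t ∈ M.enabled s → t' ∈ M.enabled s →
    ∃ s', M.run s [t, t'] = some s' ∧ M.run s [t', t] = some s')

/-- `I` is an unconditional independence relation on `M`. -/
structure System.IsIndependence (M : System S T) (I : T → T → Prop) : Prop where
  symm : ∀ t t', I t t' → I t' t
  irrefl : ∀ t, ¬ I t t
  commute : ∀ t t', I t t' → ∀ s ∈ M.reach, M.CommuteAt t t' s

/-! ### Canonical names of events

An event is either the bottom event or a pair `⟨t, H⟩` of a transition and a finite set of events.
The type of all such names is the initial algebra of `X ↦ Option (T × Finset X)`; as `Finset` is
a quotient of a polynomial functor (and not polynomial), it is obtained from `QPF.Fix`. -/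

/-- The functor `X ↦ 1 + T × Finset X`. -/
def NameF (T : Type u) (X : Type u) : Type u := Option (T × Finset X)

open Classical in
noncomputable instance NameF.instQPF (T : Type u) : QPF (NameF T) where
  map f x := Option.map (fun p => (p.1, p.2.image f)) x
  P := ⟨Option (T × ℕ), fun a => ULift.{u} (Fin (a.elim 0 Prod.snd))⟩
  abs {X} p := match p with
    | ⟨none, _⟩ => (none : Option (T × Finset X))
    | ⟨some (t, n), f⟩ => some (t, (Finset.univ : Finset (Fin n)).image fun i => f ⟨i⟩)
  repr {X} x := match x with
    | none => ⟨none, fun i => i.down.elim0⟩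
    | some (t, H) => ⟨some (t, H.card), fun i => (H.equivFin.symm i.down : X)⟩
  abs_repr := by
    intro X x
    rcases x with _ | ⟨t, H⟩
    · rfl
    · have h : (Finset.univ : Finset (Fin H.card)).image
          (fun i => (H.equivFin.symm i : X)) = H := by
        ext a
        rw [Finset.mem_image]
        constructor
        · rintro ⟨i, -, rfl⟩
          exact (H.equivFin.symm i).2
        · intro ha
          exact ⟨H.equivFin ⟨a, ha⟩, Finset.mem_univ _, by simp⟩
      exact congrArg (fun K => (some (t, K) : Option (T × Finset X))) h
  abs_map := by
    intro X Y f p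
    rcases p with ⟨_ | ⟨t, n⟩, g⟩
    · rfl
    · have h (g' : Fin n → X) : (Finset.univ : Finset (Fin n)).image (fun i => f (g' i)) =
          ((Finset.univ : Finset (Fin n)).image g').image f := by
        rw [Finset.image_image]
        rfl
      exact congrArg (fun K => (some (t, K) : Option (T × Finset Y))) (h fun i => g ⟨i⟩)

/-- Names of events: `⊥`, or `⟨t, H⟩` with `H` a finite set of names. -/
def Event (T : Type u) : Type u := QPF.Fix (NameF T)

namespace Event

/-- The bottom event `⊥`. -/
noncomputable def bot : Event T := QPF.Fix.mk (none : Option (T × Finset (Event T)))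

/-- The event `⟨t, H⟩`. -/
noncomputable def ev (t : T) (H : Finset (Event T)) : Event T :=
  QPF.Fix.mk (some (t, H) : Option (T × Finset (Event T)))

/-- A name is either `⊥` (`none`) or a pair `⟨t, H⟩` (`some (t, H)`). -/
noncomputable def dest (e : Event T) : Option (T × Finset (Event T)) := QPF.Fix.dest e

theorem dest_bot : dest (bot : Event T) = none := QPF.Fix.dest_mk _

theorem dest_ev (t : T) (H : Finset (Event T)) : dest (ev t H) = some (t, H) :=
  QPF.Fix.dest_mk _

/-- The label of an event: `h(⟨t, H⟩) = t`; the bottom event has the empty label `none`. -/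
noncomputable def label (e : Event T) : Option T := e.dest.map Prod.fst

/-- The causes of an event: those of `⟨t, H⟩` are the elements of `H`; `⊥` has none. -/
noncomputable def causes (e : Event T) : Set (Event T) :=
  {e' | ∃ p, e.dest = some p ∧ e' ∈ p.2}

/-- The set `[e]` of `e` and its causes. -/
noncomputable def loc (e : Event T) : Set (Event T) := insert e e.causes

/-- Direct conflict: neither event is in the past of the other and their labels are dependent. -/
def DirectConflict (I : T → T → Prop) (e e' : Event T) : Prop :=
  e' ∉ e.loc ∧ e ∉ e'.loc ∧ ∃ t t', e.label = some t ∧ e'.label = some t' ∧ ¬ I t t'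

/-- The conflict relation `#`: the least symmetric relation that contains direct conflict and is
inherited along causality. -/
def Conflict (I : T → T → Prop) (e e' : Event T) : Prop :=
  ∃ e₁ ∈ e.loc, ∃ e₁' ∈ e'.loc, DirectConflict I e₁ e₁'

end Event

open Event

/-! ### Interleavings, states, the unfolding -/

/-- `σ ∈ inter(C)`: `σ` is the sequence of labels of an enumeration of `C` that respects
causality. -/
def IsInterleaving (C : Set (Event T)) (σ : List T) : Prop :=
  ∃ l : List (Event T), l.Nodup ∧ (∀ e, e ∈ l ↔ e ∈ C) ∧
    l.Pairwise (fun e e' => e' ∉ e.causes) ∧ σ = l.filterMap Event.label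

/-- `state(C) = s`: some interleaving of `C` is a run that reaches `s`. (For configurations of the
unfolding there is exactly one such `s`.) -/
def HasState (M : System S T) (C : Set (Event T)) (s : S) : Prop :=
  ∃ σ, IsInterleaving C σ ∧ M.run M.init σ = some s

/-- `state(C) = state(C')`. -/
def SameState (M : System S T) (C C' : Set (Event T)) : Prop :=
  ∃ s, HasState M C s ∧ HasState M C' s

/-- Causally closed and conflict free. -/
def IsClosedConflictFree (I : T → T → Prop) (C : Set (Event T)) : Prop :=
  (∀ e ∈ C, e.causes ⊆ C) ∧ ∀ e ∈ C, ∀ e' ∈ C, ¬ Conflict I e e'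

/-- The condition on a set `H` of events of the unfolding for being a history of `t`: `H` is a
configuration that contains `⊥`, `t` is enabled at `state(H)`, and either `H = {⊥}` or every
maximal event of `H` has a label that is dependent with `t`. -/
def IsHistory (M : System S T) (I : T → T → Prop) (t : T) (H : Set (Event T)) : Prop :=
  IsClosedConflictFree I H ∧ bot ∈ H ∧
  (∃ s, HasState M H s ∧ t ∈ M.enabled s) ∧
  (H = {bot} ∨ ∀ e ∈ H, (∀ e' ∈ H, e ∉ e'.causes) → ∃ t', e.label = some t' ∧ ¬ I t' t)

/-- The events of the unfolding of `M` under `I`: all those that are obtained from `⊥` by adding,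
again and again, an event `⟨t, H⟩` with `H` a history of `t` among the events already there. -/
inductive IsEvent (M : System S T) (I : T → T → Prop) : Event T → Prop
  | bot : IsEvent M I Event.bot
  | ev (t : T) (H : Finset (Event T)) (hH : ∀ e ∈ H, IsEvent M I e)
      (hist : IsHistory M I t (H : Set (Event T))) : IsEvent M I (Event.ev t H)

/-- The configurations of the unfolding. -/
structure IsConfig (M : System S T) (I : T → T → Prop) (C : Set (Event T)) : Prop where
  isEvent : ∀ e ∈ C, IsEvent M I e
  finite : C.Finite
  closedConflictFree : IsClosedConflictFree I C

/-- Immediate conflict `e #ⁱ e'`. -/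
def ImmConflict (M : System S T) (I : T → T → Prop) (e e' : Event T) : Prop :=
  Conflict I e e' ∧ IsConfig M I (e.causes ∪ e'.loc) ∧ IsConfig M I (e.loc ∪ e'.causes)

/-- The extensions of `C`. -/
def ext (M : System S T) (I : T → T → Prop) (C : Set (Event T)) : Set (Event T) :=
  {e | IsEvent M I e ∧ e ∉ C ∧ e.causes ⊆ C}

/-- The events enabled by `C`. -/
def enab (M : System S T) (I : T → T → Prop) (C : Set (Event T)) : Set (Event T) :=
  {e | e ∈ ext M I C ∧ IsConfig M I (insert e C)}

/-- The events of `U` in immediate conflict with `e`. -/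
def immIn (M : System S T) (I : T → T → Prop) (U : Set (Event T)) (e : Event T) :
    Set (Event T) :=
  {e' | ImmConflict M I e e' ∧ e' ∈ U}

/-! ### Adequate orders -/

/-- Two sets of events are isomorphic as labelled partial orders. -/
def LabelledIso (E E' : Set (Event T)) : Prop :=
  ∃ φ : E ≃ E', (∀ x, (φ x).1.label = x.1.label) ∧
    ∀ x y, (φ x).1 ∈ (φ y).1.causes ↔ x.1 ∈ y.1.causes

/-- `prec` is an adequate order on the configurations of the unfolding: a well-founded strict
partial order that refines strict inclusion and is preserved by finite extensions (if `C ≺ C'`,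
both reach the same state, and `E`, `E'` are corresponding, that is isomorphic, extensions of `C`
and `C'`, then `C ∪ E ≺ C' ∪ E'`). -/
structure IsAdequate (M : System S T) (I : T → T → Prop)
    (prec : Set (Event T) → Set (Event T) → Prop) : Prop where
  trans : ∀ C C' C'', IsConfig M I C → IsConfig M I C' → IsConfig M I C'' →
    prec C C' → prec C' C'' → prec C C''
  wellFounded : {C | IsConfig M I C}.WellFoundedOn prec
  refines : ∀ C C', IsConfig M I C → IsConfig M I C' → C ⊂ C' → prec C C'
  preserved : ∀ C C' E E', IsConfig M I C → IsConfig M I C' → SameState M C C' → prec C C' →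
    Disjoint C E → Disjoint C' E' → IsConfig M I (C ∪ E) → IsConfig M I (C' ∪ E') →
    LabelledIso E E' → prec (C ∪ E) (C' ∪ E')

/-- The size order. -/
def sizeOrder (C C' : Set (Event T)) : Prop := C.ncard < C'.ncard

/-! ### The exploration algorithm with cutoffs -/

/-- The event `e` is declared cutoff with respect to the stored sets `U` and `G`. -/
def IsCutoff (M : System S T) (prec : Set (Event T) → Set (Event T) → Prop)
    (e : Event T) (U G : Set (Event T)) : Prop :=
  ∃ e' ∈ U ∪ G, SameState M e.loc e'.loc ∧ prec e'.loc e.loc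

/-- The possible effects of the extension procedure with the cutoff check, called on `C` with
stored sets `U`, `G` and ending with `U'`, `G'`: nothing but extensions of `C` is added to `U`, and
an extension that is not yet stored is added exactly if the cutoff check fails on the contents `V`
of `U` and `W` of `G` at the moment of its check. The checks may be made in any order (or
simultaneously), and `G` may lose any of its elements before, between and after them. -/
def Extend (M : System S T) (I : T → T → Prop) (prec : Set (Event T) → Set (Event T) → Prop)
    (C U G U' G' : Set (Event T)) : Prop :=
  U ⊆ U' ∧ U' ⊆ U ∪ ext M I C ∧ G' ⊆ G ∧
  ∀ e ∈ ext M I C \ U, ∃ V W, U ⊆ V ∧ V ⊆ U' ∧ W ⊆ G ∧ (e ∈ U' ↔ ¬ IsCutoff M prec e V W)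

/-- `J` is an alternative to `D` after `C`. -/
def IsAlternative (M : System S T) (I : T → T → Prop) (U C D J : Set (Event T)) : Prop :=
  IsConfig M I J ∧ J ⊆ U ∧ IsConfig M I (C ∪ J) ∧
  ∀ e ∈ D, ∃ e' ∈ C ∪ J, e' ∈ immIn M I U e

/-- The set `Q` of the events that have to be kept in `U`. -/
def keep (M : System S T) (I : T → T → Prop) (C D U : Set (Event T)) : Set (Event T) :=
  C ∪ D ∪ ⋃ e ∈ C ∪ D, ⋃ e' ∈ immIn M I U e, e'.loc

/-- The events that the removal procedure, called on `e`, `C`, `D`, moves from `U` to `G`. -/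
def removed (M : System S T) (I : T → T → Prop) (e : Event T) (C D U : Set (Event T)) :
    Set (Event T) :=
  (({e} ∪ ⋃ e' ∈ immIn M I U e, e'.loc) \ keep M I C D U) ∩ U

/-- The pieces of work on the call stack. A call `Explore(C, D, A)` consists of the extension
procedure, the choice of an event `e` with the left recursive call, the search for an alternative
with the right recursive call, and the removal procedure. -/
inductive Task (T : Type u) : Type u
  | explore (C D A : Set (Event T))
  | choose (C D A : Set (Event T))
  | alternative (e : Event T) (C D : Set (Event T))
  | remove (e : Event T) (C D : Set (Event T))

/-- A state of the algorithm: the global sets `U` and `G`, and the call stack. -/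
structure Machine (T : Type u) : Type u where
  U : Set (Event T)
  G : Set (Event T)
  stack : List (Task T)

/-- Initially `U = {⊥}`, `G = ∅`, and `Explore({⊥}, ∅, ∅)` is called. -/
noncomputable def Machine.start : Machine T := ⟨{bot}, ∅, [.explore {bot} ∅ ∅]⟩

/-- The steps of the algorithm. All its choices (of events, of alternatives, of the order of the
cutoff checks, of what is discarded from `G`) are left open. As `G` is read by the cutoff checks
only, it suffices that elements can be discarded from it there and in the removal procedure. -/
inductive Step (M : System S T) (I : T → T → Prop)
    (prec : Set (Event T) → Set (Event T) → Prop) : Machine T → Machine T → Prop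
  /-- Call of `Explore(C, D, A)`: extend `U`. -/
  | extend {C D A U G U' G' k} (h : Extend M I prec C U G U' G') :
      Step M I prec ⟨U, G, .explore C D A :: k⟩ ⟨U', G', .choose C D A :: k⟩
  /-- No enabled event is stored: return. -/
  | leaf {C D A U G k} (h : enab M I C ∩ U = ∅) :
      Step M I prec ⟨U, G, .choose C D A :: k⟩ ⟨U, G, k⟩
  /-- Choose an enabled stored event, from `A` unless `A = ∅`; left recursive call. -/
  | left {C D A U G k} (e : Event T) (h : e ∈ enab M I C ∩ U) (hA : A = ∅ ∨ e ∈ A) :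
      Step M I prec ⟨U, G, .choose C D A :: k⟩
        ⟨U, G, .explore (C ∪ {e}) D (A \ {e}) :: .alternative e C D :: k⟩
  /-- There is an alternative: choose one; right recursive call. -/
  | right {e C D U G k} (J : Set (Event T)) (h : IsAlternative M I U C (D ∪ {e}) J) :
      Step M I prec ⟨U, G, .alternative e C D :: k⟩
        ⟨U, G, .explore C (D ∪ {e}) (J \ C) :: .remove e C D :: k⟩
  /-- There is no alternative. -/
  | noRight {e C D U G k} (h : ∀ J, ¬ IsAlternative M I U C (D ∪ {e}) J) :
      Step M I prec ⟨U, G, .alternative e C D :: k⟩ ⟨U, G, .remove e C D :: k⟩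
  /-- Move the events that are not needed any more from `U` to `G`; return. -/
  | remove {e C D U G G' k} (h : G' ⊆ G ∪ removed M I e C D U) :
      Step M I prec ⟨U, G, .remove e C D :: k⟩ ⟨U \ removed M I e C D U, G', k⟩

/-- Every maximal execution from `m` (one that is infinite or ends in a state without a next step)
visits a state that satisfies `P`, after finitely many steps. -/
inductive Inevitable {X : Type u} (step : X → X → Prop) (P : X → Prop) : X → Prop
  | now {m : X} (h : P m) : Inevitable step P m
  | later {m : X} (h : ∃ m', step m m') (h' : ∀ m', step m m' → Inevitable step P m') :
      Inevitable step P m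

/-- The algorithm is at a call `Explore(C, D, A)` whose first argument `C` contains a configuration
`C'` with `state(C') = s`. -/
def Witnesses (M : System S T) (I : T → T → Prop) (s : S) (m : Machine T) : Prop :=
  ∃ C D A k, m.stack = .explore C D A :: k ∧ IsConfig M I C ∧
    ∃ C' ⊆ C, IsConfig M I C' ∧ HasState M C' s

end PartialOrderUnfolding

namespace PartialOrderUnfolding
open Event

variable {S : Type v} {T : Type u} {M : System S T} {I : T → T → Prop}

/-! ### Events -/

/-! Completeness rests on events that no cutoff check can reject, so that neither the contents of
`U` and `G` nor the order of the checks matters. Let N be the set `neverCutoff` of the events e for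
which no event f has the same state with [f] ≺ [e]. A ≺-minimal configuration K among those with
state s consists of such events: if [f] ≺ [e] for some e in K, then K \ [e] could be replayed after
[f], giving a ≺-smaller configuration with state s (`exists_corresponding_extension`,
`IsAdequate.exists_config_subset_neverCutoff`). Termination: a stored event has no two causally
ordered events below it whose local configurations reach the same state, since the lower one would
have made the upper one cutoff. There are finitely many such events (`finite_nonRepeating`), and
each recursive call adds a new one to C or to D. It remains to see that the exploration reaches a
configuration containing K. Call K a target of Explore(C, D, A) if it is compatible with C and each
d in D is in immediate conflict with some event of C ∪ K whose local configuration is stored. As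
long as s has not been witnessed, every call covers each of its targets K by a visited C' ⊇ K, and
it loses nothing that C and D need (`Explored`). For the chosen event e there are two cases
(`IsTarget.left_or_right`). If K has no conflict with e, it is a target of the left call. Otherwise
a stored event of K in immediate conflict with e must be found after the left call; then K is a
target of the right call, and an alternative exists. To find it, apply the covering property of the
left call to the part K₀ of K not in conflict with e: a minimal event of K in conflict with e is an
extension of the C' ⊇ K₀ visited there, it is in N, hence stored, and the removal spares it. If K₀
is not a target of the left call, then the witness in K for some d in D conflicts with e, and an
already stored event below it serves. At the initial call D is empty, so the minimal K is a target;
covering it contradicts the absence of a witness for s. -/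

theorem Event.causes_bot : (bot : Event T).causes = ∅ := by
  ext e; simp [causes, dest_bot]

theorem Event.causes_ev (t : T) (H : Finset (Event T)) : (ev t H).causes = (H : Set (Event T)) := by
  ext e; simp [causes, dest_ev]

theorem Event.label_bot : (bot : Event T).label = none := by
  simp [label, dest_bot]

theorem Event.label_ev (t : T) (H : Finset (Event T)) : (ev t H).label = some t := by
  simp [label, dest_ev]

theorem Event.mem_loc_self (e : Event T) : e ∈ e.loc := Set.mem_insert _ _

theorem Event.causes_subset_loc (e : Event T) : e.causes ⊆ e.loc := Set.subset_insert _ _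

theorem IsEvent.of_mem_causes {e e' : Event T} (he : IsEvent M I e) (h : e' ∈ e.causes) :
    IsEvent M I e' := by
  cases he with
  | bot => simp [causes_bot] at h
  | ev t H hH hist => rw [causes_ev] at h; exact hH _ h

theorem IsEvent.causes_subset {e e' : Event T} (he : IsEvent M I e) (h : e' ∈ e.causes) :
    e'.causes ⊆ e.causes := by
  cases he with
  | bot => simp [causes_bot] at h
  | ev t H hH hist => rw [causes_ev] at h ⊢; exact hist.1.1 _ h

theorem IsEvent.loc_subset_causes {e e' : Event T} (he : IsEvent M I e) (h : e' ∈ e.causes) :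
    e'.loc ⊆ e.causes :=
  Set.insert_subset h (he.causes_subset h)

theorem IsEvent.loc_subset_loc {e e' : Event T} (he : IsEvent M I e) (h : e' ∈ e.loc) :
    e'.loc ⊆ e.loc := by
  rcases h with rfl | h
  exacts [subset_rfl, (he.loc_subset_causes h).trans e.causes_subset_loc]

theorem IsEvent.notMem_causes {e : Event T} (he : IsEvent M I e) : e ∉ e.causes := by
  induction he with
  | bot => simp [causes_bot]
  | ev t H hH hist ih =>
    intro h
    have h' := h
    rw [causes_ev] at h'
    exact ih _ h' h

theorem IsEvent.finite_causes {e : Event T} (he : IsEvent M I e) : e.causes.Finite := by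
  cases he with
  | bot => simp [causes_bot]
  | ev t H hH hist => rw [causes_ev]; exact H.finite_toSet

theorem IsEvent.bot_mem_causes {e : Event T} (he : IsEvent M I e) (h : e ≠ Event.bot) :
    Event.bot ∈ e.causes := by
  cases he with
  | bot => exact absurd rfl h
  | ev t H hH hist => rw [causes_ev]; exact hist.2.1

theorem IsEvent.bot_mem_loc {e : Event T} (he : IsEvent M I e) : Event.bot ∈ e.loc := by
  by_cases h : e = Event.bot
  · rw [h]; exact mem_loc_self _
  · exact e.causes_subset_loc (he.bot_mem_causes h)

theorem IsEvent.exists_label {e : Event T} (he : IsEvent M I e) (h : e ≠ Event.bot) :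
    ∃ t, e.label = some t := by
  cases he with
  | bot => exact absurd rfl h
  | ev t H hH hist => exact ⟨t, label_ev t H⟩

theorem IsEvent.isHistory {e : Event T} {t : T} (he : IsEvent M I e) (h : e.label = some t) :
    IsHistory M I t e.causes := by
  cases he with
  | bot => simp [label_bot] at h
  | ev t' H hH hist =>
    rw [label_ev] at h
    rw [causes_ev]
    exact (Option.some.inj h) ▸ hist

/-- A set that contains an event `e` has a causally minimal element below `e`. -/
theorem IsEvent.exists_minimal {e : Event T} (he : IsEvent M I e) {X : Set (Event T)}
    (hX : e ∈ X) : ∃ m ∈ X, m ∈ e.loc ∧ ∀ g ∈ m.causes, g ∉ X := by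
  induction he with
  | bot => exact ⟨Event.bot, hX, mem_loc_self _, by simp [causes_bot]⟩
  | ev t H hH hist ih =>
    by_cases h : ∃ g ∈ H, g ∈ X
    · obtain ⟨g, hg, hgX⟩ := h
      obtain ⟨m, hm, hmg, hmin⟩ := ih g hg hgX
      have he : IsEvent M I (Event.ev t H) := .ev t H hH hist
      refine ⟨m, hm, he.loc_subset_loc ?_ hmg, hmin⟩
      exact causes_subset_loc _ (by rw [causes_ev]; exact hg)
    · push Not at h
      exact ⟨_, hX, mem_loc_self _, by rw [causes_ev]; exact h⟩

/-- A finite nonempty set of events has a causally maximal element. -/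
theorem exists_maximal_event {X : Set (Event T)} (hX : ∀ e ∈ X, IsEvent M I e) (hfin : X.Finite)
    (hne : X.Nonempty) : ∃ m ∈ X, ∀ g ∈ X, m ∉ g.causes := by
  -- The number of causes strictly increases along causality, so an event with the most causes is
  -- maximal.
  obtain ⟨m, hm, hmax⟩ := Set.exists_max_image X (fun e => e.causes.ncard) hfin hne
  refine ⟨m, hm, fun g hg h => ?_⟩
  have hlt : m.causes.ncard < g.causes.ncard :=
    Set.ncard_lt_ncard
      ⟨(hX g hg).causes_subset h, fun hs => (hX m hm).notMem_causes (hs h)⟩ (hX g hg).finite_causes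
  exact absurd (hmax g hg) (not_le.mpr hlt)

/-! ### Conflicts and configurations -/

theorem Event.DirectConflict.symm (hI : M.IsIndependence I) {e e' : Event T}
    (h : DirectConflict I e e') : DirectConflict I e' e := by
  obtain ⟨h₁, h₂, t, t', ht, ht', hd⟩ := h
  exact ⟨h₂, h₁, t', t, ht', ht, fun h => hd (hI.symm _ _ h)⟩

theorem Event.DirectConflict.conflict {e e' : Event T} (h : DirectConflict I e e') :
    Conflict I e e' :=
  ⟨e, mem_loc_self _, e', mem_loc_self _, h⟩

theorem IsEvent.conflict_of_mem_loc {e e' d : Event T} (he : IsEvent M I e') (h : e ∈ e'.loc)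
    (hc : Conflict I d e) : Conflict I d e' := by
  obtain ⟨e₁, h₁, e₁', h₁', h'⟩ := hc
  exact ⟨e₁, h₁, e₁', he.loc_subset_loc h h₁', h'⟩

theorem IsConfig.causes_subset {C : Set (Event T)} (hC : IsConfig M I C) {e : Event T}
    (he : e ∈ C) : e.causes ⊆ C :=
  hC.closedConflictFree.1 e he

theorem IsConfig.loc_subset {C : Set (Event T)} (hC : IsConfig M I C) {e : Event T}
    (he : e ∈ C) : e.loc ⊆ C :=
  Set.insert_subset he (hC.causes_subset he)

theorem IsConfig.not_conflict {C : Set (Event T)} (hC : IsConfig M I C) {e e' : Event T}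
    (he : e ∈ C) (he' : e' ∈ C) : ¬ Conflict I e e' :=
  hC.closedConflictFree.2 e he e' he'

/-- An inherited conflict comes from a direct one between events below, and a causally closed set
contains those. -/
theorem isConfig_of_not_directConflict {C : Set (Event T)} (hE : ∀ e ∈ C, IsEvent M I e)
    (hfin : C.Finite) (hcl : ∀ e ∈ C, e.causes ⊆ C)
    (h : ∀ e ∈ C, ∀ e' ∈ C, ¬ DirectConflict I e e') : IsConfig M I C := by
  refine ⟨hE, hfin, hcl, ?_⟩
  rintro e he e' he' ⟨e₁, h₁, e₁', h₁', hd⟩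
  exact h e₁ (Set.insert_subset he (hcl e he) h₁) e₁' (Set.insert_subset he' (hcl e' he') h₁') hd

theorem IsConfig.mono {C C' : Set (Event T)} (hC : IsConfig M I C) (h : C' ⊆ C)
    (hcl : ∀ e ∈ C', e.causes ⊆ C') : IsConfig M I C' :=
  ⟨fun e he => hC.isEvent e (h he), hC.finite.subset h, hcl,
    fun _ he _ he' => hC.not_conflict (h he) (h he')⟩

theorem isConfig_empty : IsConfig M I (∅ : Set (Event T)) :=
  isConfig_of_not_directConflict (by simp) Set.finite_empty (by simp) (by simp)

theorem isConfig_singleton_bot : IsConfig M I ({bot} : Set (Event T)) := by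
  refine isConfig_of_not_directConflict ?_ (Set.finite_singleton _) ?_ ?_
  · rintro e rfl; exact .bot
  · rintro e rfl; simp [causes_bot]
  · rintro _ rfl _ rfl h
    exact h.1 (mem_loc_self _)

theorem IsEvent.isConfig_causes {e : Event T} (he : IsEvent M I e) : IsConfig M I e.causes := by
  refine ⟨fun g hg => he.of_mem_causes hg, he.finite_causes, ?_⟩
  cases he with
  | bot => rw [causes_bot]; exact isConfig_empty.closedConflictFree (M := M)
  | ev t H hH hist => rw [causes_ev]; exact hist.1

/-- Adding an event with causes in a configuration gives a configuration if there is no direct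
conflict with the new event. -/
theorem IsConfig.insert_event (hI : M.IsIndependence I) {C : Set (Event T)} (hC : IsConfig M I C)
    {e : Event T} (he : IsEvent M I e) (hsub : e.causes ⊆ C)
    (h : ∀ g ∈ C, ¬ DirectConflict I e g) : IsConfig M I (insert e C) := by
  refine isConfig_of_not_directConflict ?_ (hC.finite.insert e) ?_ ?_
  · rintro g (rfl | hg)
    exacts [he, hC.isEvent g hg]
  · rintro g (rfl | hg)
    exacts [hsub.trans (Set.subset_insert _ _),
      (hC.causes_subset hg).trans (Set.subset_insert _ _)]
  · rintro g (rfl | hg) g' (rfl | hg') hd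
    · exact hd.1 (mem_loc_self _)
    · exact h g' hg' hd
    · exact h g hg (hd.symm hI)
    · exact hC.not_conflict hg hg' hd.conflict

theorem IsEvent.isConfig_loc (hI : M.IsIndependence I) {e : Event T} (he : IsEvent M I e) :
    IsConfig M I e.loc :=
  he.isConfig_causes.insert_event hI he subset_rfl fun _ hg hd => hd.1 (causes_subset_loc _ hg)

/-- The empty configuration lacks `bot`, so compatibility of a target with the initial `{bot}` needs
this. Having no label, `bot` is in no direct conflict. -/
theorem IsConfig.insert_bot (hI : M.IsIndependence I) {C : Set (Event T)} (hC : IsConfig M I C) :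
    IsConfig M I (insert bot C) := by
  refine hC.insert_event hI .bot (by simp [causes_bot]) ?_
  rintro g - ⟨-, -, t, -, h, -⟩
  simp [label_bot] at h

theorem IsConfig.diff_maximal {C : Set (Event T)} (hC : IsConfig M I C) {e : Event T}
    (hmax : ∀ g ∈ C, e ∉ g.causes) : IsConfig M I (C \ {e}) :=
  hC.mono Set.sdiff_subset fun g hg _ hx =>
    ⟨hC.causes_subset hg.1 hx, fun h => hmax g hg.1 (Set.mem_singleton_iff.mp h ▸ hx)⟩

/-- Concurrent events of a configuration have independent labels. -/
theorem IsConfig.independent {C : Set (Event T)} (hC : IsConfig M I C) {e e' : Event T}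
    (he : e ∈ C) (he' : e' ∈ C) (h : e' ∉ e.loc) (h' : e ∉ e'.loc) {t t' : T}
    (ht : e.label = some t) (ht' : e'.label = some t') : I t t' := by
  by_contra hd
  exact hC.not_conflict he he' (DirectConflict.conflict ⟨h, h', t, t', ht, ht', hd⟩)

/-! ### Runs -/

theorem System.run_append (M : System S T) (s : S) (σ τ : List T) :
    M.run s (σ ++ τ) = (M.run s σ).bind fun s' => M.run s' τ := by
  induction σ generalizing s with
  | nil => simp [System.run]
  | cons t σ ih =>
    simp only [List.cons_append, System.run]
    cases M.fire t s with
    | none => rfl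
    | some s' => exact ih s'

theorem System.run_singleton (M : System S T) (s : S) (t : T) : M.run s [t] = M.fire t s := by
  simp [System.run]

theorem System.mem_reach_of_run {s s' : S} {σ : List T} (hs : s ∈ M.reach)
    (h : M.run s σ = some s') : s' ∈ M.reach := by
  obtain ⟨τ, hτ⟩ := hs
  exact ⟨τ ++ σ, by rw [System.run_append, hτ]; exact h⟩

/-- Independent transitions neither enable nor disable a transition. -/
theorem System.IsIndependence.enabled_iff_of_run (hI : M.IsIndependence I) {t : T} {σ : List T}
    (hσ : ∀ u ∈ σ, I u t) {s s' : S} (hs : s ∈ M.reach) (h : M.run s σ = some s') :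
    t ∈ M.enabled s ↔ t ∈ M.enabled s' := by
  induction σ generalizing s with
  | nil =>
    simp only [System.run, Option.some.injEq] at h
    rw [h]
  | cons u σ ih =>
    simp only [System.run, Option.bind_eq_some_iff] at h
    obtain ⟨s₁, h₁, h₂⟩ := h
    rw [(hI.commute u t (hσ u (by simp)) s hs).1 s₁ h₁]
    exact ih (fun v hv => hσ v (by simp [hv]))
      (System.mem_reach_of_run hs ((M.run_singleton s u).trans h₁)) h₂

/-! ### Linearizations -/

/-- The list `l` enumerates `C` in an order that respects causality. -/
def IsLinearization (C : Set (Event T)) (l : List (Event T)) : Prop :=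
  l.Nodup ∧ (∀ e, e ∈ l ↔ e ∈ C) ∧ l.Pairwise (fun e e' => e' ∉ e.causes)

theorem hasState_iff {C : Set (Event T)} {s : S} :
    HasState M C s ↔
      ∃ l, IsLinearization C l ∧ M.run M.init (l.filterMap Event.label) = some s := by
  constructor
  · rintro ⟨σ, ⟨l, h₁, h₂, h₃, rfl⟩, h⟩
    exact ⟨l, ⟨h₁, h₂, h₃⟩, h⟩
  · rintro ⟨l, ⟨h₁, h₂, h₃⟩, h⟩
    exact ⟨_, ⟨l, h₁, h₂, h₃, rfl⟩, h⟩

theorem isLinearization_empty : IsLinearization (∅ : Set (Event T)) [] := by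
  simp [IsLinearization]

theorem IsLinearization.concat {C : Set (Event T)} (hcl : ∀ e ∈ C, e.causes ⊆ C)
    {l : List (Event T)} (hl : IsLinearization C l) {e : Event T} (he : e ∉ C) :
    IsLinearization (insert e C) (l ++ [e]) := by
  obtain ⟨h₁, h₂, h₃⟩ := hl
  refine ⟨?_, ?_, ?_⟩
  · rw [List.nodup_append]
    refine ⟨h₁, by simp, ?_⟩
    rintro a ha b hb rfl
    rw [List.mem_singleton] at hb
    exact he (hb ▸ (h₂ a).mp ha)
  · intro g
    rw [List.mem_append, h₂, List.mem_singleton, Set.mem_insert_iff, or_comm]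
  · rw [List.pairwise_append]
    refine ⟨h₃, by simp, ?_⟩
    intro a ha b hb hc
    rw [List.mem_singleton] at hb
    exact he (hb ▸ hcl a ((h₂ a).mp ha) hc)

theorem IsLinearization.of_concat {C : Set (Event T)} {l : List (Event T)} {e : Event T}
    (h : IsLinearization C (l ++ [e])) (hC : IsConfig M I C) :
    e ∈ C ∧ (∀ g ∈ C, e ∉ g.causes) ∧ IsLinearization (C \ {e}) l := by
  obtain ⟨h₁, h₂, h₃⟩ := h
  rw [List.nodup_append] at h₁
  rw [List.pairwise_append] at h₃
  have heC : e ∈ C := (h₂ e).mp (by simp)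
  refine ⟨heC, ?_, h₁.1, ?_, h₃.1⟩
  · intro g hg
    have := (h₂ g).mpr hg
    rw [List.mem_append, List.mem_singleton] at this
    rcases this with hgl | rfl
    · exact h₃.2.2 g hgl e (by simp)
    · exact (hC.isEvent g hg).notMem_causes
  · intro g
    constructor
    · intro hg
      exact ⟨(h₂ g).mp (by simp [hg]), fun h => h₁.2.2 g hg e (by simp) h⟩
    · rintro ⟨hg, hne⟩
      have := (h₂ g).mpr hg
      rw [List.mem_append, List.mem_singleton] at this
      exact this.resolve_right hne

theorem IsConfig.insert_minimal {C C₀ : Set (Event T)} (hC : IsConfig M I C)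
    (hC₀ : IsConfig M I C₀) (h : C₀ ⊆ C) {m : Event T} (hm : m ∈ C)
    (hmin : ∀ g ∈ m.causes, g ∉ C \ C₀) : IsConfig M I (insert m C₀) := by
  refine hC.mono (Set.insert_subset hm h) ?_
  rintro g (rfl | hg) x hx
  · by_contra hxC
    exact hmin x hx ⟨hC.causes_subset hm hx, fun h' => hxC (Set.mem_insert_of_mem _ h')⟩
  · exact Set.mem_insert_of_mem _ (hC₀.causes_subset hg hx)

/-- A linearization of a subconfiguration extends to one of the configuration. -/
theorem IsConfig.exists_linearization_append {C C₀ : Set (Event T)} (hC : IsConfig M I C)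
    (hC₀ : IsConfig M I C₀) (h : C₀ ⊆ C) {l₀ : List (Event T)} (hl₀ : IsLinearization C₀ l₀) :
    ∃ l, IsLinearization C (l₀ ++ l) := by
  induction hn : (C \ C₀).ncard generalizing C₀ l₀ with
  | zero =>
    have h0 : C \ C₀ = ∅ := (Set.ncard_eq_zero (hC.finite.subset Set.sdiff_subset)).mp hn
    have : C = C₀ := (Set.sdiff_eq_empty.mp h0).antisymm h
    exact ⟨[], by rw [List.append_nil, this]; exact hl₀⟩
  | succ n ih =>
    obtain ⟨e, he⟩ := Set.nonempty_of_ncard_ne_zero (by omega : (C \ C₀).ncard ≠ 0)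
    obtain ⟨m, hm, -, hmin⟩ := (hC.isEvent e he.1).exists_minimal he
    have hsub : insert m C₀ ⊆ C := Set.insert_subset hm.1 h
    have hcard : (C \ insert m C₀).ncard = n := by
      have h1 : C \ insert m C₀ = (C \ C₀) \ {m} := by
        ext x; simp only [Set.mem_sdiff, Set.mem_insert_iff, Set.mem_singleton_iff]; tauto
      rw [h1, Set.ncard_sdiff_singleton_of_mem hm, hn]; rfl
    obtain ⟨l, hl⟩ := ih (hC.insert_minimal hC₀ h hm.1 hmin) hsub
      (hl₀.concat hC₀.closedConflictFree.1 hm.2) hcard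
    exact ⟨m :: l, by simpa using hl⟩

theorem IsConfig.exists_linearization {C : Set (Event T)} (hC : IsConfig M I C) :
    ∃ l, IsLinearization C l :=
  hC.exists_linearization_append isConfig_empty (Set.empty_subset _) isLinearization_empty

/-! ### The state of a configuration -/

/-- If all linearizations of the configurations `H` and `C` reach the states `sH` and `s`, where
`H ⊆ C` and the events of `C` outside `H` are independent of `t`, then `t` is enabled at `sH` iff it
is enabled at `s`. -/
theorem enabled_iff_of_independent_diff (hI : M.IsIndependence I) {C H : Set (Event T)}
    (hC : IsConfig M I C) (hH : IsConfig M I H) (h : H ⊆ C) {t : T}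
    (hind : ∀ g ∈ C \ H, ∀ u, g.label = some u → I u t) {s sH : S} (hsH : HasState M H sH)
    (hs : ∀ l, IsLinearization C l → M.run M.init (l.filterMap Event.label) = some s) :
    t ∈ M.enabled sH ↔ t ∈ M.enabled s := by
  obtain ⟨l₀, hl₀, hr₀⟩ := hasState_iff.mp hsH
  obtain ⟨l, hl⟩ := hC.exists_linearization_append hH h hl₀
  have hr := hs _ hl
  rw [List.filterMap_append, System.run_append, hr₀] at hr
  refine hI.enabled_iff_of_run ?_ ⟨_, hr₀⟩ hr
  intro u hu
  obtain ⟨g, hg, hgu⟩ := List.mem_filterMap.mp hu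
  refine hind g ⟨(hl.2.1 g).mp (by simp [hg]), fun hgH => ?_⟩ u hgu
  exact (List.nodup_append.mp hl.1).2.2 g ((hl₀.2.1 g).mpr hgH) g hg rfl

theorem IsConfig.label_mem_enabled (hI : M.IsIndependence I) {C : Set (Event T)}
    (hC : IsConfig M I C) {e : Event T} (he : e ∈ C) (hmax : ∀ g ∈ C, e ∉ g.causes) {t : T}
    (ht : e.label = some t) {s : S}
    (hs : ∀ l, IsLinearization (C \ {e}) l → M.run M.init (l.filterMap Event.label) = some s) :
    t ∈ M.enabled s := by
  have hev := hC.isEvent e he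
  have hsub : e.causes ⊆ C \ {e} := fun g hg =>
    ⟨hC.causes_subset he hg, fun h => hev.notMem_causes (Set.mem_singleton_iff.mp h ▸ hg)⟩
  obtain ⟨-, -, ⟨sH, hsH, hen⟩, -⟩ := hev.isHistory ht
  -- The events of `C \ {e}` outside the causes of `e` are concurrent with `e`, as `e` is maximal;
  -- hence their labels are independent of `t`, and `t` stays enabled from the state of the causes
  -- onwards.
  refine (enabled_iff_of_independent_diff hI (hC.diff_maximal hmax) hev.isConfig_causes hsub ?_
    hsH hs).mp hen
  rintro g ⟨⟨hgC, hne⟩, hgH⟩ u hu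
  refine hC.independent hgC he ?_ ?_ hu ht
  · rintro (h | h)
    exacts [hne h.symm, hmax g hgC h]
  · rintro (h | h)
    exacts [hne h, hgH h]

/-- All linearizations of a configuration are runs to the same state. -/
theorem IsConfig.exists_run_eq (hI : M.IsIndependence I) {C : Set (Event T)}
    (hC : IsConfig M I C) :
    ∃ s, ∀ l, IsLinearization C l → M.run M.init (l.filterMap Event.label) = some s := by
  induction hn : C.ncard using Nat.strong_induction_on generalizing C with
  | _ n ih =>
  have hdiff : ∀ e ∈ C, (∀ g ∈ C, e ∉ g.causes) → ∃ s, ∀ l, IsLinearization (C \ {e}) l →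
      M.run M.init (l.filterMap Event.label) = some s := fun e he hmax =>
    ih _ (hn ▸ Set.ncard_sdiff_singleton_lt_of_mem he hC.finite) (hC.diff_maximal hmax) rfl
  obtain ⟨l, hl⟩ := hC.exists_linearization
  rcases List.eq_nil_or_concat l with rfl | ⟨l₁, e, rfl⟩
  · refine ⟨M.init, fun l' hl' => ?_⟩
    have : l' = [] := List.eq_nil_iff_forall_not_mem.mpr fun g hg =>
      List.not_mem_nil ((hl.2.1 g).mpr ((hl'.2.1 g).mp hg))
    rw [this]; rfl
  rw [List.concat_eq_append] at hl
  obtain ⟨he, hmax, hl₁⟩ := hl.of_concat hC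
  obtain ⟨s₁, hs₁⟩ := hdiff e he hmax
  by_cases hbot : e = bot
  · -- then `C = {⊥}`
    subst hbot
    refine ⟨s₁, fun l' hl' => ?_⟩
    have hall : ∀ g ∈ C, g = bot := fun g hg => by
      by_contra hne
      exact hmax g hg ((hC.isEvent g hg).bot_mem_causes hne)
    rcases List.eq_nil_or_concat l' with rfl | ⟨l₂, g, rfl⟩
    · exact absurd ((hl'.2.1 _).mpr he) List.not_mem_nil
    · rw [List.concat_eq_append] at hl' ⊢
      obtain ⟨hg, hgmax, hl₂⟩ := hl'.of_concat hC
      obtain rfl := hall g hg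
      rw [List.filterMap_append, System.run_append, hs₁ _ hl₂]
      simp [label_bot, System.run]
  obtain ⟨t, ht⟩ := (hC.isEvent e he).exists_label hbot
  obtain ⟨s, hs⟩ := hC.label_mem_enabled hI he hmax ht hs₁
  refine ⟨s, fun l' hl' => ?_⟩
  rcases List.eq_nil_or_concat l' with rfl | ⟨l₂, e', rfl⟩
  · exact absurd ((hl'.2.1 _).mpr he) List.not_mem_nil
  rw [List.concat_eq_append] at hl' ⊢
  obtain ⟨he', hmax', hl₂⟩ := hl'.of_concat hC
  by_cases hee : e' = e
  · subst hee
    rw [List.filterMap_append, System.run_append, hs₁ _ hl₂]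
    simp [ht, System.run, hs]
  have hbot' : e' ≠ bot := by
    rintro rfl
    exact hmax' e he ((hC.isEvent e he).bot_mem_causes hbot)
  obtain ⟨t', ht'⟩ := (hC.isEvent e' he').exists_label hbot'
  obtain ⟨s₂, hs₂⟩ := hdiff e' he' hmax'
  have hC₁ := hC.diff_maximal hmax
  have hmax₁ : ∀ g ∈ C \ {e}, e' ∉ g.causes := fun g hg => hmax' g hg.1
  -- Two linearizations with different last events `e`, `e'` are compared through `C` without both:
  -- the two maximal events are concurrent, so their labels commute at its state `s₃`.
  obtain ⟨s₃, hs₃⟩ := ih _ (hn ▸ (Set.ncard_le_ncard Set.sdiff_subset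
      (hC.finite.subset Set.sdiff_subset)).trans_lt
      (Set.ncard_sdiff_singleton_lt_of_mem he hC.finite)) (hC₁.diff_maximal hmax₁) rfl
  have hC₃ := hC₁.diff_maximal hmax₁
  obtain ⟨l₃, hl₃⟩ := hC₃.exists_linearization
  have hlin₁ : IsLinearization (C \ {e}) (l₃ ++ [e']) := by
    have := hl₃.concat hC₃.closedConflictFree.1 (e := e') (by simp)
    rwa [Set.insert_sdiff_singleton,
      Set.insert_eq_of_mem (show e' ∈ C \ {e} from ⟨he', hee⟩)] at this
  have hcomm : (C \ {e}) \ {e'} = (C \ {e'}) \ {e} := by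
    ext x; simp only [Set.mem_sdiff, Set.mem_singleton_iff]; tauto
  have hlin₂ : IsLinearization (C \ {e'}) (l₃ ++ [e]) := by
    have := hl₃.concat hC₃.closedConflictFree.1 (e := e) (by simp)
    rwa [hcomm, Set.insert_sdiff_singleton,
      Set.insert_eq_of_mem (show e ∈ C \ {e'} from ⟨he, fun h => hee h.symm⟩)] at this
  have hr₃ := hs₃ _ hl₃
  have hr₁ := hs₁ _ hlin₁
  have hr₂ := hs₂ _ hlin₂
  rw [List.filterMap_append, System.run_append, hr₃] at hr₁ hr₂
  simp only [List.filterMap_cons, ht, ht', List.filterMap_nil, Option.bind_some, System.run,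
    Option.bind_fun_some] at hr₁ hr₂
  have hind : I t t' := hC.independent he he'
    (by rintro (h | h); exacts [hee h, hmax' e he h])
    (by rintro (h | h); exacts [hee h.symm, hmax e' he' h]) ht ht'
  obtain ⟨s₄, h₄, h₄'⟩ := (hI.commute t t' hind s₃ ⟨_, hr₃⟩).2 ⟨_, hr₂⟩ ⟨_, hr₁⟩
  simp only [System.run, hr₁, hr₂, Option.bind_some, Option.bind_fun_some] at h₄ h₄'
  rw [List.filterMap_append, System.run_append, hs₂ _ hl₂]
  simp only [List.filterMap_cons, ht', List.filterMap_nil, Option.bind_some, System.run,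
    Option.bind_fun_some]
  rw [h₄, ← h₄', hs]

theorem IsConfig.exists_hasState (hI : M.IsIndependence I) {C : Set (Event T)}
    (hC : IsConfig M I C) : ∃ s, HasState M C s := by
  obtain ⟨s, hs⟩ := hC.exists_run_eq hI
  obtain ⟨l, hl⟩ := hC.exists_linearization
  exact ⟨s, hasState_iff.mpr ⟨l, hl, hs l hl⟩⟩

theorem HasState.run_eq (hI : M.IsIndependence I) {C : Set (Event T)} (hC : IsConfig M I C)
    {s : S} (h : HasState M C s) {l : List (Event T)} (hl : IsLinearization C l) :
    M.run M.init (l.filterMap Event.label) = some s := by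
  obtain ⟨s', hs'⟩ := hC.exists_run_eq hI
  obtain ⟨l', hl', h⟩ := hasState_iff.mp h
  rw [hs' l hl, ← hs' l' hl', h]

theorem HasState.unique (hI : M.IsIndependence I) {C : Set (Event T)} (hC : IsConfig M I C)
    {s s' : S} (h : HasState M C s) (h' : HasState M C s') : s = s' := by
  obtain ⟨l, hl, hr⟩ := hasState_iff.mp h
  exact Option.some.inj (hr.symm.trans (h'.run_eq hI hC hl))

theorem HasState.mem_reach {C : Set (Event T)} {s : S} (h : HasState M C s) : s ∈ M.reach := by
  obtain ⟨σ, -, h⟩ := h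
  exact ⟨σ, h⟩

theorem hasState_singleton_bot : HasState M ({bot} : Set (Event T)) M.init :=
  hasState_iff.mpr ⟨[bot], by simp [IsLinearization], by simp [label_bot, System.run]⟩

theorem HasState.insert_event {C : Set (Event T)} (hC : IsConfig M I C) {e : Event T} (he : e ∉ C)
    {t : T} (ht : e.label = some t) {s s' : S} (hs : HasState M C s) (h : M.fire t s = some s') :
    HasState M (insert e C) s' := by
  obtain ⟨l, hl, hr⟩ := hasState_iff.mp hs
  refine hasState_iff.mpr ⟨_, hl.concat hC.closedConflictFree.1 he, ?_⟩
  rw [List.filterMap_append, System.run_append, hr]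
  simp [ht, System.run, h]

theorem HasState.fire_eq (hI : M.IsIndependence I) {C : Set (Event T)} (hC : IsConfig M I C)
    {e : Event T} (hCe : IsConfig M I (insert e C)) (he : e ∉ C) {t : T}
    (ht : e.label = some t) {s s' : S} (hs : HasState M C s)
    (hs' : HasState M (insert e C) s') : M.fire t s = some s' := by
  obtain ⟨l, hl, hr⟩ := hasState_iff.mp hs
  have := hs'.run_eq hI hCe (hl.concat hC.closedConflictFree.1 he)
  rw [List.filterMap_append, System.run_append, hr] at this
  simpa [ht, System.run] using this

/-! ### Extensions of configurations -/

/-- The causes of an event enabled by a configuration are `⊥` and the events below the dependent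
events of the configuration. -/
theorem mem_causes_iff_of_mem_enab {C : Set (Event T)} (hC : IsConfig M I C) (hbot : bot ∈ C)
    {e : Event T} (he : e ∈ enab M I C) {t : T} (ht : e.label = some t) (y : Event T) :
    y ∈ e.causes ↔ y = bot ∨ ∃ g ∈ C, ∃ u, g.label = some u ∧ ¬ I u t ∧ y ∈ g.loc := by
  obtain ⟨⟨hev, heC, hsub⟩, hCe⟩ := he
  constructor
  · intro hy
    obtain ⟨-, -, -, h | h⟩ := hev.isHistory ht
    · rw [h] at hy; exact Or.inl hy
    -- A maximal event above `y` among the causes is maximal among all the causes, so its label is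
    -- dependent with `t`.
    obtain ⟨m, ⟨hm, hym⟩, hmax⟩ := exists_maximal_event (M := M) (I := I)
      (X := {g | g ∈ e.causes ∧ y ∈ g.loc}) (fun g hg => hev.of_mem_causes hg.1)
      (hev.finite_causes.subset fun g hg => hg.1) ⟨y, hy, mem_loc_self _⟩
    obtain ⟨u, hu, hd⟩ := h m hm fun g hg hmg => hmax g
      ⟨hg, causes_subset_loc _ ((hev.of_mem_causes hg).loc_subset_causes hmg hym)⟩ hmg
    exact Or.inr ⟨m, hsub hm, u, hu, hd, hym⟩
  · rintro (rfl | ⟨g, hg, u, hu, hd, hy⟩)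
    · refine hev.bot_mem_causes ?_
      rintro rfl
      exact heC hbot
    -- A dependent event `g` that is not a cause of `e` would be concurrent with `e` inside a
    -- configuration.
    · by_contra hye
      refine hd (hCe.independent (Set.mem_insert_of_mem _ hg) (Set.mem_insert _ _)
        (fun h => heC (hC.loc_subset hg h)) (fun h => ?_) hu ht)
      rcases h with rfl | h
      exacts [heC hg, hye (hev.loc_subset_causes h hy)]

/-- If `t` is enabled at the state of a configuration, then the configuration enables an event
with label `t`. -/
theorem exists_mem_enab_label (hI : M.IsIndependence I) {C : Set (Event T)}
    (hC : IsConfig M I C) (hbot : bot ∈ C) {s : S} (hs : HasState M C s) {t : T}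
    (ht : t ∈ M.enabled s) : ∃ e ∈ enab M I C, e.label = some t := by
  -- By `mem_causes_iff_of_mem_enab` this is the only possible history. What it omits from `C` is
  -- independent of `t`, so `t` is enabled at the state of `H` too.
  let H : Set (Event T) :=
    {y | y ∈ C ∧ (y = bot ∨ ∃ g ∈ C, ∃ u, g.label = some u ∧ ¬ I u t ∧ y ∈ g.loc)}
  have hHC : H ⊆ C := fun y hy => hy.1
  have hH : IsConfig M I H := by
    refine hC.mono hHC fun y hy x hx => ⟨hC.causes_subset hy.1 hx, ?_⟩
    rcases hy.2 with rfl | ⟨g, hg, u, hu, hd, hyg⟩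
    · simp [causes_bot] at hx
    · exact Or.inr ⟨g, hg, u, hu, hd,
        (hC.isEvent g hg).loc_subset_loc hyg (causes_subset_loc _ hx)⟩
  have hbotH : bot ∈ H := ⟨hbot, Or.inl rfl⟩
  obtain ⟨sH, hsH⟩ := hH.exists_hasState hI
  have hen : t ∈ M.enabled sH := by
    refine (enabled_iff_of_independent_diff hI hC hH hHC ?_ hsH
      fun l hl => hs.run_eq hI hC hl).mpr ht
    rintro g ⟨hg, hgH⟩ u hu
    by_contra hd
    exact hgH ⟨hg, Or.inr ⟨g, hg, u, hu, hd, mem_loc_self _⟩⟩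
  have hcoe : (hH.finite.toFinset : Set (Event T)) = H := hH.finite.coe_toFinset
  have hist : IsHistory M I t (hH.finite.toFinset : Set (Event T)) := by
    rw [hcoe]
    refine ⟨hH.closedConflictFree, hbotH, ⟨sH, hsH, hen⟩, or_iff_not_imp_left.mpr fun hne => ?_⟩
    intro m hm hmax
    rcases hm.2 with rfl | ⟨g, hg, u, hu, hd, hmg⟩
    · refine absurd (Set.eq_singleton_iff_unique_mem.mpr ⟨hbotH, fun g hg => ?_⟩) hne
      by_contra hgb
      exact hmax g hg ((hC.isEvent g hg.1).bot_mem_causes hgb)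
    · have hgH : g ∈ H := ⟨hg, Or.inr ⟨g, hg, u, hu, hd, mem_loc_self _⟩⟩
      rcases hmg with rfl | hmg
      exacts [⟨u, hu, hd⟩, absurd hmg (hmax g hgH)]
  have hev : IsEvent M I (ev t hH.finite.toFinset) :=
    .ev t _ (fun e he => hH.isEvent e (hH.finite.mem_toFinset.mp he)) hist
  have hcauses : (ev t hH.finite.toFinset).causes = H := by rw [causes_ev, hcoe]
  have hdep : ∀ g ∈ C, ∀ u, g.label = some u → ¬ I u t →
      g ∈ (ev t hH.finite.toFinset).causes := fun g hg u hu hd =>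
    hcauses.symm.subset ⟨hg, Or.inr ⟨g, hg, u, hu, hd, mem_loc_self _⟩⟩
  have hsub : (ev t hH.finite.toFinset).causes ⊆ C := hcauses.trans_subset hHC
  refine ⟨_, ⟨⟨hev, fun h => ?_, hsub⟩, hC.insert_event hI hev hsub ?_⟩, label_ev _ _⟩
  -- Since `t` is dependent with itself, an event of `C` with label `t` belongs to the history; the
  -- new event would be its own cause.
  · exact hev.notMem_causes (hdep _ h t (label_ev _ _) (hI.irrefl t))
  · rintro g hg ⟨h₁, -, t', u, ht', hu, hd⟩
    rw [label_ev, Option.some.injEq] at ht'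
    subst ht'
    exact h₁ (causes_subset_loc _ (hdep g hg u hu fun h => hd (hI.symm _ _ h)))

/-- Every reachable state is the state of a configuration. -/
theorem exists_config_hasState (hI : M.IsIndependence I) {s : S} (hs : s ∈ M.reach) :
    ∃ C, IsConfig M I C ∧ HasState M C s := by
  obtain ⟨σ, hσ⟩ := hs
  suffices H : ∀ (C : Set (Event T)) s₀, IsConfig M I C → bot ∈ C → HasState M C s₀ →
      M.run s₀ σ = some s → ∃ C, IsConfig M I C ∧ HasState M C s from
    H {bot} M.init isConfig_singleton_bot rfl hasState_singleton_bot hσ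
  clear hσ
  induction σ with
  | nil =>
    intro C s₀ hC _ hs₀ h
    rw [System.run, Option.some.injEq] at h
    exact ⟨C, hC, h ▸ hs₀⟩
  | cons t σ ih =>
    intro C s₀ hC hbot hs₀ h
    rw [System.run, Option.bind_eq_some_iff] at h
    obtain ⟨s₁, h₁, h₂⟩ := h
    obtain ⟨e, he, het⟩ := exists_mem_enab_label hI hC hbot hs₀ ⟨s₁, h₁⟩
    exact ih _ s₁ he.2 (Set.mem_insert_of_mem _ hbot) (hs₀.insert_event hC he.1.2.1 het h₁) h₂

theorem labelledIso_of_bijOn {E E' : Set (Event T)} {f : Event T → Event T}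
    (hf : Set.BijOn f E E') (hlab : ∀ x ∈ E, (f x).label = x.label)
    (hc : ∀ x ∈ E, ∀ y ∈ E, f x ∈ (f y).causes ↔ x ∈ y.causes) : LabelledIso E E' :=
  ⟨hf.equiv f, fun x => hlab x x.2, fun x y => hc x x.2 y y.2⟩

theorem LabelledIso.symm {E E' : Set (Event T)} (h : LabelledIso E E') : LabelledIso E' E := by
  obtain ⟨φ, h₁, h₂⟩ := h
  refine ⟨φ.symm, fun x => ?_, fun x y => ?_⟩
  · rw [← h₁, φ.apply_symm_apply]
  · rw [← h₂, φ.apply_symm_apply, φ.apply_symm_apply]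

theorem SameState.symm {C C' : Set (Event T)} (h : SameState M C C') : SameState M C' C := by
  obtain ⟨s, h₁, h₂⟩ := h
  exact ⟨s, h₂, h₁⟩

/-- Every extension of a configuration corresponds to an extension of any other configuration with
the same state. -/
theorem exists_corresponding_extension (hI : M.IsIndependence I) {C C' E : Set (Event T)}
    (hC : IsConfig M I C) (hC' : IsConfig M I C') (hbot : bot ∈ C) (hbot' : bot ∈ C')
    (hs : SameState M C C') (hdisj : Disjoint C E) (hCE : IsConfig M I (C ∪ E)) :
    ∃ (E' : Set (Event T)) (f : Event T → Event T), Disjoint C' E' ∧ IsConfig M I (C' ∪ E') ∧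
      SameState M (C ∪ E) (C' ∪ E') ∧ Set.BijOn f E E' ∧ (∀ x ∈ E, (f x).label = x.label) ∧
      ∀ x ∈ E, ∀ y ∈ E, f x ∈ (f y).causes ↔ x ∈ y.causes := by
  classical
  induction hn : E.ncard generalizing E with
  | zero =>
    obtain rfl := (Set.ncard_eq_zero (hCE.finite.subset Set.subset_union_right)).mp hn
    refine ⟨∅, id, Set.disjoint_empty _, ?_, ?_, Set.bijOn_id _, by simp, by simp⟩
    · simpa using hC'
    · simpa using hs
  | succ n ih =>
    -- Induction on the size of `E`: a maximal event is split off, the rest is transported, and an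
    -- event with the same label is added on the other side.
    obtain ⟨m, hm, hmax⟩ := exists_maximal_event (M := M) (I := I) (X := E)
      (fun e he => hCE.isEvent e (Or.inr he)) (hCE.finite.subset Set.subset_union_right)
      (Set.nonempty_of_ncard_ne_zero (by omega))
    have hmC : m ∉ C := fun h => Set.disjoint_left.mp hdisj h hm
    have hmax' : ∀ g ∈ C ∪ E, m ∉ g.causes := by
      rintro g (hg | hg) h
      exacts [hmC (hC.causes_subset hg h), hmax g hg h]
    have hmev := hCE.isEvent m (Or.inr hm)
    have hmbot : m ≠ bot := by rintro rfl; exact hmC hbot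
    obtain ⟨t, ht⟩ := hmev.exists_label hmbot
    set E₀ := E \ {m} with hE₀
    have hins : insert m E₀ = E := by
      rw [hE₀, Set.insert_sdiff_singleton, Set.insert_eq_of_mem hm]
    have hins' : insert m (C ∪ E₀) = C ∪ E := by rw [← Set.union_insert, hins]
    have hm₀ : m ∉ C ∪ E₀ := by simp [hE₀, hmC]
    have hC₀ : IsConfig M I (C ∪ E₀) := by
      have h := hCE.diff_maximal hmax'
      rwa [← hins', Set.insert_sdiff_self_of_notMem hm₀] at h
    obtain ⟨E₀', f, hdisj', hC₀', ⟨s, hs₀, hs₀'⟩, hf, hlab, hc⟩ :=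
      ih (hdisj.mono_right Set.sdiff_subset) hC₀
        (by rw [Set.ncard_sdiff_singleton_of_mem hm, hn]; rfl)
    have hmen : m ∈ enab M I (C ∪ E₀) := by
      refine ⟨⟨hmev, hm₀, fun x hx => ?_⟩, by rwa [hins']⟩
      have := hCE.causes_subset (Or.inr hm) hx
      rw [← hins'] at this
      exact this.resolve_left fun h => hmev.notMem_causes (h ▸ hx)
    obtain ⟨s₁, hs₁⟩ := hCE.exists_hasState hI
    have hfire := hs₀.fire_eq hI hC₀ hmen.2 hm₀ ht (by rwa [hins'])
    obtain ⟨m', hm', ht'⟩ := exists_mem_enab_label hI hC₀' (Or.inl hbot') hs₀' ⟨s₁, hfire⟩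
    have hm₀' : m' ∉ C' ∪ E₀' := hm'.1.2.1
    have hmE₀ : m ∉ E₀ := fun h => hm₀ (Or.inr h)
    have hfm : Set.EqOn (Function.update f m m') f E₀ := fun x hx =>
      Function.update_of_ne (fun h : x = m => hmE₀ (h ▸ hx)) _ _
    have hbij : Set.BijOn (Function.update f m m') E (insert m' E₀') := by
      have h := (hf.congr hfm.symm).insert (a := m)
        (by rw [Function.update_self]; exact fun h => hm₀' (Or.inr h))
      rwa [hins, Function.update_self] at h
    refine ⟨insert m' E₀', Function.update f m m', ?_, ?_, ⟨s₁, hs₁, ?_⟩, hbij, ?_, ?_⟩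
    · rw [Set.disjoint_insert_right]
      exact ⟨fun h => hm₀' (Or.inl h), hdisj'⟩
    · rw [Set.union_insert]; exact hm'.2
    · rw [Set.union_insert]; exact hs₀'.insert_event hC₀' hm₀' ht' hfire
    · intro x hx
      rw [← hins] at hx
      rcases hx with rfl | hx
      · rw [Function.update_self, ht, ht']
      · rw [hfm hx, hlab x hx]
    · intro x hx y hy
      rw [← hins] at hx hy
      rcases hx with rfl | hx <;> rcases hy with rfl | hy
      · rw [Function.update_self]
        exact iff_of_false hm'.1.1.notMem_causes hmev.notMem_causes
      · rw [Function.update_self, hfm hy]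
        exact iff_of_false
          (fun h => hm₀' (hC₀'.causes_subset (Or.inr (hf.mapsTo hy)) h)) (hmax y hy.1)
      -- Which events of the extension are causes of `m` is determined by their labels and their
      -- order alone, and both are preserved by `f`.
      · rw [Function.update_self, hfm hx, mem_causes_iff_of_mem_enab hC₀ (Or.inl hbot) hmen ht,
          mem_causes_iff_of_mem_enab hC₀' (Or.inl hbot') hm' ht']
        have hxC : x ∉ C := fun h => Set.disjoint_left.mp hdisj h hx.1
        have hxC' : f x ∉ C' := fun h => Set.disjoint_left.mp hdisj' h (hf.mapsTo hx)
        have hloc : ∀ g ∈ E₀, f x ∈ (f g).loc ↔ x ∈ g.loc := fun g hg =>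
          or_congr (hf.injOn.eq_iff hx hg) (hc x hx g hg)
        constructor
        · rintro (h | ⟨g, hg | hg, u, hu, hd, hxg⟩)
          · exact absurd (h ▸ hbot') hxC'
          · exact absurd (hC'.loc_subset hg hxg) hxC'
          · obtain ⟨g', hg', rfl⟩ := hf.surjOn hg
            exact Or.inr ⟨g', Or.inr hg', u, hlab g' hg' ▸ hu, hd, (hloc g' hg').mp hxg⟩
        · rintro (h | ⟨g, hg | hg, u, hu, hd, hxg⟩)
          · exact absurd (h ▸ hbot) hxC
          · exact absurd (hC.loc_subset hg hxg) hxC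
          · exact Or.inr ⟨f g, Or.inr (hf.mapsTo hg), u, (hlab g hg).trans hu, hd,
              (hloc g hg).mpr hxg⟩
      · rw [hfm hx, hfm hy]; exact hc x hx y hy

/-! ### Adequate orders -/

theorem isAdequate_sizeOrder : IsAdequate M I sizeOrder where
  trans _ _ _ _ _ _ h h' := lt_trans h h'
  wellFounded := by
    have h : WellFounded (sizeOrder (T := T)) := InvImage.wf Set.ncard Nat.lt_wfRel.wf
    exact h.wellFoundedOn
  refines _ _ _ h hlt := Set.ncard_lt_ncard hlt h.finite
  preserved C C' E E' _ _ _ hlt hd hd' h h' hiso := by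
    obtain ⟨φ, -, -⟩ := hiso
    have hcard : E.ncard = E'.ncard := Nat.card_congr φ
    have hU := h.finite
    have hU' := h'.finite
    rw [Set.finite_union] at hU hU'
    rw [sizeOrder, Set.ncard_union_eq hd hU.1 hU.2, Set.ncard_union_eq hd' hU'.1 hU'.2, hcard]
    exact Nat.add_lt_add_right hlt _

/-- The events that are not cutoff with respect to any set of events. -/
def neverCutoff (M : System S T) (I : T → T → Prop)
    (prec : Set (Event T) → Set (Event T) → Prop) : Set (Event T) :=
  {e | ∀ f, IsEvent M I f → SameState M e.loc f.loc → ¬ prec f.loc e.loc}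

theorem not_isCutoff_of_mem_neverCutoff {prec : Set (Event T) → Set (Event T) → Prop}
    {e : Event T} (he : e ∈ neverCutoff M I prec) {U G : Set (Event T)}
    (hU : ∀ f ∈ U, IsEvent M I f) (hG : ∀ f ∈ G, IsEvent M I f) : ¬ IsCutoff M prec e U G := by
  rintro ⟨f, hf, hs, hp⟩
  exact he f (hf.elim (hU f) (hG f)) hs hp

/-- A reachable state is the state of a configuration without events that can ever be cutoff. -/
theorem IsAdequate.exists_config_subset_neverCutoff (hI : M.IsIndependence I)
    {prec : Set (Event T) → Set (Event T) → Prop} (hprec : IsAdequate M I prec) {s : S}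
    (hs : s ∈ M.reach) :
    ∃ K, IsConfig M I K ∧ HasState M K s ∧ K ⊆ neverCutoff M I prec := by
  obtain ⟨K₀, hK₀, hsK₀⟩ := exists_config_hasState hI hs
  -- `K` is ≺-minimal among the configurations with state `s`.
  obtain ⟨⟨K, hK⟩, hsK, hmin⟩ := hprec.wellFounded.has_min {K | HasState M K.1 s}
    ⟨⟨K₀, hK₀⟩, hsK₀⟩
  refine ⟨K, hK, hsK, fun e he f hf hsame hp => ?_⟩
  have hev := hK.isEvent e he
  have hunion : e.loc ∪ K \ e.loc = K := Set.union_sdiff_cancel (hK.loc_subset he)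
  obtain ⟨E', φ, hdisj', hE', ⟨s', hs₁, hs₂⟩, hbij, hlab, hc⟩ :=
    exists_corresponding_extension hI (hev.isConfig_loc hI) (hf.isConfig_loc hI) hev.bot_mem_loc
      hf.bot_mem_loc hsame (E := K \ e.loc) Set.disjoint_sdiff_right (by rwa [hunion])
  rw [hunion] at hs₁
  obtain rfl := hs₁.unique hI hK hsK
  -- The copy of `K \ [e]` after `[f]` has state `s` and precedes `K`, against minimality.
  have hlt := hprec.preserved _ _ _ _ (hf.isConfig_loc hI) (hev.isConfig_loc hI) hsame.symm hp
    hdisj' Set.disjoint_sdiff_right hE' (by rwa [hunion]) (labelledIso_of_bijOn hbij hlab hc).symm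
  rw [hunion] at hlt
  exact hmin ⟨_, hE'⟩ hs₂ hlt

/-! ### Finiteness of the stored events -/

/-- The events below which no causal chain visits a state twice. -/
def nonRepeating (M : System S T) (I : T → T → Prop) : Set (Event T) :=
  {e | IsEvent M I e ∧ ∀ f ∈ e.loc, ∀ g ∈ f.causes, ¬ SameState M f.loc g.loc}

/-- The names of events of nesting depth at most `n` with labels in `R`. -/
def depthLE (R : Set T) : ℕ → Set (Event T)
  | 0 => {bot}
  | n + 1 => insert bot
      ((fun p : T × Finset (Event T) => ev p.1 p.2) '' (R ×ˢ {H : Finset (Event T) | ↑H ⊆ depthLE R n}))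

theorem finite_depthLE {R : Set T} (hR : R.Finite) (n : ℕ) : (depthLE R n).Finite := by
  induction n with
  | zero => exact Set.finite_singleton _
  | succ n ih =>
    refine ((hR.prod ?_).image _).insert _
    refine Set.Finite.of_finite_image (ih.finite_subsets.subset ?_)
      (Finset.coe_injective.injOn (s := {H : Finset (Event T) | ↑H ⊆ depthLE R n}))
    rintro _ ⟨H, hH, rfl⟩
    exact hH

/-- An event of large depth has many states below it, if these do not repeat. -/
theorem exists_states_of_notMem_depthLE (hI : M.IsIndependence I) {R : Set T}
    (hR : ∀ s ∈ M.reach, M.enabled s ⊆ R) (n : ℕ) {e : Event T} (he : e ∈ nonRepeating M I)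
    (hn : e ∉ depthLE R n) :
    ∃ X : Finset S, X.card = n + 1 ∧ ∀ s ∈ X, ∃ f ∈ e.loc, HasState M f.loc s := by
  classical
  induction n generalizing e with
  | zero =>
    obtain ⟨s, hs⟩ := (he.1.isConfig_loc hI).exists_hasState hI
    exact ⟨{s}, rfl, fun s' hs' => ⟨e, mem_loc_self _, Finset.mem_singleton.mp hs' ▸ hs⟩⟩
  | succ n ih =>
    obtain ⟨hev, hrep⟩ := he
    have hg : ∃ g ∈ e.causes, g ∉ depthLE R n := by
      by_contra! h
      refine hn ?_
      cases hev with
      | bot => exact Set.mem_insert _ _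
      | ev t H hH hist =>
        rw [causes_ev] at h
        obtain ⟨-, -, ⟨s, hs, ht⟩, -⟩ := hist
        exact Set.mem_insert_of_mem _ ⟨(t, H), ⟨hR s hs.mem_reach ht, h⟩, rfl⟩
    obtain ⟨g, hge, hgn⟩ := hg
    obtain ⟨X, hX, hXs⟩ := ih ⟨hev.of_mem_causes hge, fun f hf =>
      hrep f (hev.loc_subset_loc (causes_subset_loc _ hge) hf)⟩ hgn
    obtain ⟨s, hs⟩ := (hev.isConfig_loc hI).exists_hasState hI
    refine ⟨insert s X, ?_, ?_⟩
    -- The state of `[e]` is new: it differs from that of every event strictly below `e`.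
    · rw [Finset.card_insert_of_notMem, hX]
      intro hsX
      obtain ⟨f, hf, hfs⟩ := hXs s hsX
      exact hrep e (mem_loc_self _) f (hev.loc_subset_causes hge hf) ⟨s, hs, hfs⟩
    · intro s' hs'
      rcases Finset.mem_insert.mp hs' with rfl | hs'
      · exact ⟨e, mem_loc_self _, hs⟩
      · obtain ⟨f, hf, hfs⟩ := hXs s' hs'
        exact ⟨f, causes_subset_loc _ (hev.loc_subset_causes hge hf), hfs⟩

/-- Pigeonhole: an event of depth beyond the number of reachable states would have one state too
many below it, and finite branching leaves finitely many names of bounded depth. -/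
theorem finite_nonRepeating (hI : M.IsIndependence I) (hreach : M.reach.Finite)
    (hbranch : ∀ s ∈ M.reach, (M.enabled s).Finite) : (nonRepeating M I).Finite := by
  have hR : (⋃ s ∈ M.reach, M.enabled s).Finite := hreach.biUnion hbranch
  refine (finite_depthLE hR M.reach.ncard).subset fun e he => ?_
  by_contra hn
  obtain ⟨X, hX, hXs⟩ := exists_states_of_notMem_depthLE hI
    (fun s hs => Set.subset_biUnion_of_mem (u := fun s => M.enabled s) hs) _ he hn
  have : (X : Set S).ncard ≤ M.reach.ncard := Set.ncard_le_ncard (fun s hs => by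
    obtain ⟨f, -, hf⟩ := hXs s hs
    exact hf.mem_reach) hreach
  rw [Set.ncard_coe_finset] at this
  omega

theorem bot_mem_nonRepeating : bot ∈ nonRepeating M I := by
  refine ⟨.bot, fun f hf g hg => ?_⟩
  rcases hf with rfl | hf
  · simp [causes_bot] at hg
  · simp [causes_bot] at hf

/-- An extension that passes the cutoff check has no repeated states below it. -/
theorem mem_nonRepeating_of_not_isCutoff (hI : M.IsIndependence I)
    {prec : Set (Event T) → Set (Event T) → Prop} (hprec : IsAdequate M I prec)
    {C U G : Set (Event T)} {e : Event T} (he : e ∈ ext M I C) (hC : C ⊆ nonRepeating M I)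
    (hU : C ⊆ U) (hcut : ¬ IsCutoff M prec e U G) : e ∈ nonRepeating M I := by
  obtain ⟨hev, -, hsub⟩ := he
  refine ⟨hev, ?_⟩
  rintro f (rfl | hf) g hg
  · intro hs
    -- The cutoff witness is the cause `g` itself: it lies in `C`, hence in `U`, and `[g]` is
    -- strictly included in `[e]`.
    refine hcut ⟨g, Or.inl (hU (hsub hg)), hs, hprec.refines _ _
      ((hev.of_mem_causes hg).isConfig_loc hI) (hev.isConfig_loc hI) ?_⟩
    exact ⟨hev.loc_subset_loc (causes_subset_loc _ hg),
      fun h => hev.notMem_causes (hev.loc_subset_causes hg (h (mem_loc_self _)))⟩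
  · exact (hC (hsub hf)).2 f (mem_loc_self _) g hg

/-! ### Immediate conflicts -/

/-- If an event enabled by a configuration `C` is in conflict with a configuration `K` compatible
with `C`, then it is in immediate conflict with an event of `K`. -/
theorem exists_immConflict (hI : M.IsIndependence I) {C K : Set (Event T)}
    (hK : IsConfig M I K) (hCK : IsConfig M I (C ∪ K)) {e : Event T}
    (he : e ∈ enab M I C) {g : Event T} (hg : g ∈ K) (hconf : Conflict I e g) :
    ∃ e' ∈ g.loc, ImmConflict M I e e' := by
  obtain ⟨⟨hev, heC, hsub⟩, hCe⟩ := he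
  obtain ⟨m, ⟨hm, hmc⟩, hmg, hmin⟩ := (hK.isEvent g hg).exists_minimal
    (X := {g | g ∈ K ∧ Conflict I e g}) ⟨hg, hconf⟩
  have hmev := hK.isEvent m hm
  have h₀ : IsConfig M I (e.causes ∪ m.causes) := by
    refine hCK.mono (Set.union_subset_union hsub (hK.causes_subset hm)) ?_
    rintro x (hx | hx)
    exacts [(hev.causes_subset hx).trans Set.subset_union_left,
      (hmev.causes_subset hx).trans Set.subset_union_right]
  refine ⟨m, hmg, hmc, ?_, ?_⟩
  · refine hCK.mono (Set.union_subset_union hsub (hK.loc_subset hm)) ?_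
    rintro x (hx | hx)
    exacts [(hev.causes_subset hx).trans Set.subset_union_left,
      ((causes_subset_loc x).trans (hmev.loc_subset_loc hx)).trans Set.subset_union_right]
  · rw [loc, Set.insert_union]
    refine h₀.insert_event hI hev Set.subset_union_left ?_
    rintro x (hx | hx) hd
    · exact hd.1 (causes_subset_loc _ hx)
    · exact hmin x hx ⟨hK.causes_subset hm hx, hd.conflict⟩

variable {prec : Set (Event T) → Set (Event T) → Prop}

/-! ### Events that stay stored -/

/-- In passing from the stored set `U` to `U'`, no event is lost that is needed for `C` and `D`. -/
def Preserves (M : System S T) (I : T → T → Prop) (C D U U' : Set (Event T)) : Prop :=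
  keep M I C D U ∩ U ⊆ U'

theorem mem_keep_iff {C D U : Set (Event T)} {x : Event T} :
    x ∈ keep M I C D U ↔ x ∈ C ∪ D ∨
      ∃ e ∈ C ∪ D, ∃ e', ImmConflict M I e e' ∧ e' ∈ U ∧ x ∈ e'.loc := by
  simp only [keep, immIn, Set.mem_union, Set.mem_iUnion, Set.mem_ofPred_eq, exists_prop, and_assoc]

/-- `keep` depends on the stored set through the stored immediate conflicts. These are themselves
kept, so they still protect their causes in the second stage. -/
theorem Preserves.trans {C D U U' U'' : Set (Event T)} (h : Preserves M I C D U U')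
    (h' : Preserves M I C D U' U'') : Preserves M I C D U U'' := by
  rintro x ⟨hx, hxU⟩
  refine h' ⟨?_, h ⟨hx, hxU⟩⟩
  rw [mem_keep_iff] at hx ⊢
  rcases hx with hx | ⟨e, he, e', hee, he'U, hxe⟩
  · exact Or.inl hx
  · exact Or.inr ⟨e, he, e', hee,
      h ⟨mem_keep_iff.mpr (Or.inr ⟨e, he, e', hee, he'U, mem_loc_self _⟩), he'U⟩, hxe⟩

/-- Recursive calls enlarge `C` or `D` and so protect more than their caller needs. -/
theorem Preserves.anti {C D C' D' U U' : Set (Event T)} (h : Preserves M I C' D' U U')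
    (hC : C ⊆ C') (hD : D ⊆ D') : Preserves M I C D U U' := by
  rintro x ⟨hx, hxU⟩
  refine h ⟨?_, hxU⟩
  have hCD : C ∪ D ⊆ C' ∪ D' := Set.union_subset_union hC hD
  rw [mem_keep_iff] at hx ⊢
  exact hx.imp (fun h => hCD h) fun ⟨e, he, h⟩ => ⟨e, hCD he, h⟩

theorem preserves_of_subset {C D U U' : Set (Event T)} (h : U ⊆ U') : Preserves M I C D U U' :=
  Set.inter_subset_right.trans h

theorem preserves_diff_removed (e : Event T) (C D U : Set (Event T)) :
    Preserves M I C D U (U \ removed M I e C D U) :=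
  fun _ hx => ⟨hx.2, fun h => h.1.2 hx.1⟩

theorem Preserves.subset {C D U U' : Set (Event T)} (h : Preserves M I C D U U') (hC : C ⊆ U) :
    C ⊆ U' :=
  fun _ hx => h ⟨mem_keep_iff.mpr (Or.inl (Or.inl hx)), hC hx⟩

theorem Preserves.loc_subset {C D U U' : Set (Event T)} (h : Preserves M I C D U U')
    {e e' : Event T} (he : e ∈ C ∪ D) (hee : ImmConflict M I e e') (hU : e'.loc ⊆ U) :
    e'.loc ⊆ U' :=
  fun _ hx => h ⟨mem_keep_iff.mpr (Or.inr ⟨e, he, e', hee, hU (mem_loc_self _), hx⟩), hU hx⟩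

/-! ### Targets of the exploration -/

/-- The configuration `K` of events in `N` is a target of an exploration of `C` and `D`: it is
compatible with `C` and stored events witness its conflict with each event of `D`. -/
structure IsTarget (M : System S T) (I : T → T → Prop) (N C D U K : Set (Event T)) : Prop where
  isConfig : IsConfig M I K
  isConfig_union : IsConfig M I (C ∪ K)
  subset : K ⊆ N
  conflict : ∀ d ∈ D, ∃ e ∈ C ∪ K, ImmConflict M I d e ∧ e.loc ⊆ U

theorem IsTarget.preserved {N C D U U' K : Set (Event T)} (hK : IsTarget M I N C D U K)
    (h : Preserves M I C D U U') : IsTarget M I N C D U' K where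
  isConfig := hK.isConfig
  isConfig_union := hK.isConfig_union
  subset := hK.subset
  conflict d hd := by
    obtain ⟨e, he, hde, hU⟩ := hK.conflict d hd
    exact ⟨e, he, hde, h.loc_subset (Or.inr hd) hde hU⟩

theorem IsTarget.exists_isAlternative {N C D U K : Set (Event T)}
    (hK : IsTarget M I N C D U K) (hC : IsConfig M I C) : ∃ J, IsAlternative M I U C D J := by
  -- `K` need not be stored; the alternative is the part of `C ∪ K` that is stored together with its
  -- causes.
  have hJ : {x | x ∈ C ∪ K ∧ x.loc ⊆ U} ⊆ C ∪ K := fun x hx => hx.1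
  have hcl : ∀ x ∈ C ∪ K, x.loc ⊆ U → x.causes ⊆ {x | x ∈ C ∪ K ∧ x.loc ⊆ U} :=
    fun x hx hxU y hy => ⟨hK.isConfig_union.causes_subset hx hy,
      ((hK.isConfig_union.isEvent x hx).loc_subset_loc (causes_subset_loc _ hy)).trans hxU⟩
  refine ⟨{x | x ∈ C ∪ K ∧ x.loc ⊆ U}, hK.isConfig_union.mono hJ fun x hx => hcl x hx.1 hx.2,
    fun x hx => hx.2 (mem_loc_self _), ?_, fun d hd => ?_⟩
  · refine hK.isConfig_union.mono (Set.union_subset Set.subset_union_left hJ) ?_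
    rintro x (hx | hx)
    exacts [(hC.causes_subset hx).trans Set.subset_union_left,
      (hcl x hx.1 hx.2).trans Set.subset_union_right]
  · obtain ⟨e, he, hde, hU⟩ := hK.conflict d hd
    exact ⟨e, Or.inr ⟨he, hU⟩, hde, hU (mem_loc_self _)⟩

/-- An exploration that starts from `C` and ends with the stored set `U` covers `K`: it has visited
a configuration `C'` that contains `K` but no configuration with state `s`, and the extensions of
`C'` in `N` that are in immediate conflict with an event of `C` are still stored. -/
def Covers (M : System S T) (I : T → T → Prop) (N : Set (Event T)) (s : S)
    (C K U : Set (Event T)) : Prop :=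
  ∃ C', K ⊆ C' ∧ (∀ K' ⊆ C', IsConfig M I K' → ¬ HasState M K' s) ∧
    ∀ e, IsEvent M I e → e ∈ N → e.causes ⊆ C' → (∃ c ∈ C, ImmConflict M I c e) → e.loc ⊆ U

theorem Covers.anti {N C C' K U : Set (Event T)} {s : S} (h : Covers M I N s C' K U)
    (hC : C ⊆ C') : Covers M I N s C K U := by
  obtain ⟨X, hKX, hX, hs⟩ := h
  exact ⟨X, hKX, hX, fun e h₁ h₂ h₃ ⟨c, hc, h₄⟩ => hs e h₁ h₂ h₃ ⟨c, hC hc, h₄⟩⟩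

theorem Covers.preserved {N C D K U U' : Set (Event T)} {s : S} (h : Covers M I N s C K U)
    (hU : Preserves M I C D U U') : Covers M I N s C K U' := by
  obtain ⟨X, hKX, hX, hs⟩ := h
  exact ⟨X, hKX, hX, fun e h₁ h₂ h₃ ⟨c, hc, h₄⟩ =>
    hU.loc_subset (Or.inl hc) h₄ (hs e h₁ h₂ h₃ ⟨c, hc, h₄⟩)⟩

/-! ### Invariants of the exploration -/

/-- The invariant at a call `Explore(C, D, A)` with stored sets `U` and `G`. -/
structure Explorable (M : System S T) (I : T → T → Prop) (C D A U G : Set (Event T)) : Prop where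
  isConfig : IsConfig M I C
  bot_mem : bot ∈ C
  subset : C ⊆ U
  isConfig_union : IsConfig M I (C ∪ A)
  subset' : A ⊆ U
  notMem : ∀ e ∈ A, e ∉ C
  conflict : ∀ d ∈ D, ∃ e ∈ C ∪ A, Conflict I d e
  stored : U ⊆ nonRepeating M I
  discarded : ∀ e ∈ G, IsEvent M I e

/-- The relation between the stored sets before and after a call `Explore(C, D, A)` that visits no
configuration which contains one with state `s`. -/
structure Explored (M : System S T) (I : T → T → Prop) (N : Set (Event T)) (s : S)
    (C D U U' G' : Set (Event T)) : Prop where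
  stored : U' ⊆ nonRepeating M I
  discarded : ∀ e ∈ G', IsEvent M I e
  preserves : Preserves M I C D U U'
  covers : ∀ K, IsTarget M I N C D U K → Covers M I N s C K U'

/-- `Inevitable` demands that a next step exist; checking all extensions simultaneously against the
current sets provides one. -/
theorem exists_extend (M : System S T) (I : T → T → Prop)
    (prec : Set (Event T) → Set (Event T) → Prop) (C U G : Set (Event T)) :
    ∃ U', Extend M I prec C U G U' G := by
  refine ⟨U ∪ {e | e ∈ ext M I C ∧ ¬ IsCutoff M prec e U G}, Set.subset_union_left,
    Set.union_subset_union_right U fun e he => he.1, subset_rfl, fun e he =>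
    ⟨U, G, subset_rfl, Set.subset_union_left, subset_rfl, ?_⟩⟩
  constructor
  · rintro (h | h)
    exacts [absurd h he.2, h.2]
  · exact fun h => Or.inr ⟨he.1, h⟩

theorem Extend.subset_nonRepeating (hI : M.IsIndependence I) (hprec : IsAdequate M I prec)
    {C U G U' G' : Set (Event T)} (h : Extend M I prec C U G U' G') (hC : C ⊆ U)
    (hU : U ⊆ nonRepeating M I) : U' ⊆ nonRepeating M I := by
  obtain ⟨-, h₁, -, h₂⟩ := h
  intro e he
  by_cases heU : e ∈ U
  · exact hU heU
  have hext := (h₁ he).resolve_left heU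
  obtain ⟨V, W, hUV, -, -, hiff⟩ := h₂ e ⟨hext, heU⟩
  exact mem_nonRepeating_of_not_isCutoff hI hprec hext (hC.trans hU) (hC.trans hUV) (hiff.mp he)

/-- The check quantifies over stored or discarded events of the unfolding, none of which can make
`e` cutoff. -/
theorem Extend.mem_of_mem_neverCutoff {C U G U' G' : Set (Event T)}
    (h : Extend M I prec C U G U' G') (hU' : U' ⊆ nonRepeating M I)
    (hG : ∀ e ∈ G, IsEvent M I e) {e : Event T} (he : e ∈ ext M I C)
    (hN : e ∈ neverCutoff M I prec) : e ∈ U' := by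
  by_cases heU : e ∈ U
  · exact h.1 heU
  obtain ⟨V, W, -, hV, hW, hiff⟩ := h.2.2.2 e ⟨he, heU⟩
  exact hiff.mpr (not_isCutoff_of_mem_neverCutoff hN (fun f hf => (hU' (hV hf)).1)
    fun f hf => hG f (hW hf))

/-- A minimal event of a configuration outside a compatible configuration `C` is enabled by `C`. -/
theorem exists_mem_enab {C K : Set (Event T)} (hC : IsConfig M I C) (hCK : IsConfig M I (C ∪ K))
    {e : Event T} (he : e ∈ K) (heC : e ∉ C) : ∃ m ∈ K, m ∈ enab M I C := by
  obtain ⟨m, ⟨hm, hmC⟩, -, hmin⟩ := (hCK.isEvent e (Or.inr he)).exists_minimal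
    (X := {x | x ∈ C ∪ K ∧ x ∉ C}) ⟨Or.inr he, heC⟩
  refine ⟨m, hm.resolve_left hmC, ⟨hCK.isEvent m hm, hmC, fun x hx => ?_⟩, ?_⟩
  · by_contra hxC
    exact hmin x hx ⟨hCK.causes_subset hm hx, hxC⟩
  · exact hCK.insert_minimal hC Set.subset_union_left hm
      fun x hx h => hmin x hx ⟨h.1, h.2⟩

/-- An exploration that stops after the extension of the stored set satisfies the
postcondition. -/
theorem explored_of_leaf {C D A U G U' G' : Set (Event T)}
    {s : S} (h : Explorable M I C D A U G)
    (hs : ∀ K ⊆ C, IsConfig M I K → ¬ HasState M K s) (hext : Extend M I prec C U G U' G')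
    (hU' : U' ⊆ nonRepeating M I) (hleaf : enab M I C ∩ U' = ∅) :
    Explored M I (neverCutoff M I prec) s C D U U' G' where
  stored := hU'
  discarded e he := h.discarded e (hext.2.2.1 he)
  preserves := preserves_of_subset hext.1
  covers K hK := by
    -- The covering configuration is `C` itself: if `K` were not inside `C`, a minimal missing event
    -- would be enabled and stored, and the call would not stop here.
    refine ⟨C, fun e he => ?_, hs, ?_⟩
    · by_contra heC
      obtain ⟨m, hm, hmen⟩ := exists_mem_enab h.isConfig hK.isConfig_union he heC
      exact Set.eq_empty_iff_forall_notMem.mp hleaf m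
        ⟨hmen, hext.mem_of_mem_neverCutoff hU' h.discarded hmen.1 (hK.subset hm)⟩
    · rintro e he heN hsub ⟨c, hc, hce⟩
      have heC : e ∉ C := fun heC => h.isConfig.not_conflict hc heC hce.1
      exact Set.insert_subset (hext.mem_of_mem_neverCutoff hU' h.discarded ⟨he, heC, hsub⟩ heN)
        (hsub.trans (h.subset.trans hext.1))

/-- After the exploration of the left branch, each target is a target of the left branch or of the
right branch. -/
theorem IsTarget.left_or_right (hI : M.IsIndependence I) {N C D U U' G' K : Set (Event T)} {s : S}
    {e : Event T} (hC : IsConfig M I C) (hK : IsTarget M I N C D U K) (he : e ∈ enab M I C)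
    (hL : Explored M I N s (C ∪ {e}) D U U' G') :
    IsTarget M I N (C ∪ {e}) D U K ∨ IsTarget M I N C (D ∪ {e}) U' K := by
  have hinsert : ∀ X : Set (Event T), C ∪ {e} ∪ X = insert e (C ∪ X) := fun X => by
    rw [Set.union_singleton, Set.insert_union]
  have hnotC : ∀ g ∈ C, ¬ Conflict I e g := fun g hg =>
    he.2.not_conflict (Set.mem_insert _ _) (Set.mem_insert_of_mem _ hg)
  have hev := he.1.1
  by_cases hconf : ∃ g ∈ K, Conflict I e g
  · right
    suffices H : ∃ e' ∈ K, ImmConflict M I e e' ∧ e'.loc ⊆ U' by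
      refine ⟨hK.isConfig, hK.isConfig_union, hK.subset, ?_⟩
      rintro d (hd | rfl)
      · exact (hK.preserved (hL.preserves.anti Set.subset_union_left subset_rfl)).conflict d hd
      · obtain ⟨e', he', h⟩ := H
        exact ⟨e', Or.inr he', h⟩
    have hK₀ : IsConfig M I {g | g ∈ K ∧ ¬ Conflict I e g} :=
      hK.isConfig.mono (fun g hg => hg.1) fun g hg x hx =>
        ⟨hK.isConfig.causes_subset hg.1 hx, fun h => hg.2
          ((hK.isConfig.isEvent g hg.1).conflict_of_mem_loc (causes_subset_loc _ hx) h)⟩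
    -- The question is whether the part of `K` not in conflict with `e` still witnesses the
    -- conflicts with `D`, that is, whether it is a target of the left call.
    by_cases hD : ∀ d ∈ D, ∃ e' ∈ C ∪ {g | g ∈ K ∧ ¬ Conflict I e g},
        ImmConflict M I d e' ∧ e'.loc ⊆ U
    · have hCK₀ : IsConfig M I (C ∪ {g | g ∈ K ∧ ¬ Conflict I e g}) := by
        refine hK.isConfig_union.mono (Set.union_subset_union_right C fun g hg => hg.1) ?_
        rintro x (hx | hx)
        exacts [(hC.causes_subset hx).trans Set.subset_union_left,
          (hK₀.causes_subset hx).trans Set.subset_union_right]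
      have hT : IsTarget M I N (C ∪ {e}) D U {g | g ∈ K ∧ ¬ Conflict I e g} := by
        refine ⟨hK₀, ?_, fun g hg => hK.subset hg.1, fun d hd => ?_⟩
        · rw [hinsert]
          refine hCK₀.insert_event hI hev (he.1.2.2.trans Set.subset_union_left) ?_
          rintro g (hg | hg) hd
          exacts [hnotC g hg hd.conflict, hg.2 hd.conflict]
        · obtain ⟨e', he', h⟩ := hD d hd
          exact ⟨e', he'.imp_left Or.inl, h⟩
      obtain ⟨X, hKX, -, hX⟩ := hL.covers _ hT
      obtain ⟨g, hg, hge⟩ := hconf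
      obtain ⟨e', he'g, hee'⟩ := exists_immConflict hI hK.isConfig hK.isConfig_union he hg hge
      -- The causes of `e'` are not in conflict with `e`, so they lie in the visited `X`; the last
      -- clause of `Covers` then says that `e'` is still stored.
      have he' := hK.isConfig.loc_subset hg he'g
      refine ⟨e', he', hee', hX e' (hK.isConfig.isEvent e' he') (hK.subset he') ?_
        ⟨e, Or.inr rfl, hee'⟩⟩
      exact fun x hx => hKX ⟨hK.isConfig.causes_subset he' hx,
        hee'.2.2.not_conflict (Or.inl (mem_loc_self _)) (Or.inr hx)⟩
    -- Here the stored witness `g` for some `d` conflicts with `e`. An immediate conflict of `e`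
    -- occurs below `g`, and the left call has kept `[g]` because of `d`.
    · push Not at hD
      obtain ⟨d, hd, hD⟩ := hD
      obtain ⟨g, hg, hdg, hgU⟩ := hK.conflict d hd
      have hgK : g ∈ K := hg.resolve_left fun h => hD g (Or.inl h) hdg hgU
      have hge : Conflict I e g := by
        by_contra h
        exact hD g (Or.inr ⟨hgK, h⟩) hdg hgU
      obtain ⟨e', he'g, hee'⟩ := exists_immConflict hI hK.isConfig hK.isConfig_union he hgK hge
      exact ⟨e', hK.isConfig.loc_subset hgK he'g, hee',
        ((hK.isConfig.isEvent g hgK).loc_subset_loc he'g).trans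
          (hL.preserves.loc_subset (Or.inr hd) hdg hgU)⟩
  · left
    push Not at hconf
    refine ⟨hK.isConfig, ?_, hK.subset, fun d hd => ?_⟩
    · rw [hinsert]
      refine hK.isConfig_union.insert_event hI hev (he.1.2.2.trans Set.subset_union_left) ?_
      rintro g (hg | hg) hd
      exacts [hnotC g hg hd.conflict, hconf g hg hd.conflict]
    · obtain ⟨e', he', h⟩ := hK.conflict d hd
      exact ⟨e', he'.imp_left Or.inl, h⟩

theorem discarded_of_remove {C D U G G' : Set (Event T)} {e : Event T}
    (hU : U ⊆ nonRepeating M I) (hG : ∀ e ∈ G, IsEvent M I e)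
    (hG' : G' ⊆ G ∪ removed M I e C D U) : ∀ e ∈ G', IsEvent M I e := fun x hx =>
  (hG' hx).elim (hG x) fun h => (hU h.2).1

/-- The postcondition after the left branch, if there is no alternative. -/
theorem explored_of_noRight (hI : M.IsIndependence I) {N C D U U₁ U₂ G₂ G' : Set (Event T)}
    {s : S} {e : Event T} (hC : IsConfig M I C) (hU : U ⊆ U₁) (he : e ∈ enab M I C)
    (hL : Explored M I N s (C ∪ {e}) D U₁ U₂ G₂)
    (hno : ∀ J, ¬ IsAlternative M I U₂ C (D ∪ {e}) J) (hG' : G' ⊆ G₂ ∪ removed M I e C D U₂) :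
    Explored M I N s C D U (U₂ \ removed M I e C D U₂) G' where
  stored := Set.sdiff_subset.trans hL.stored
  discarded := discarded_of_remove hL.stored hL.discarded hG'
  preserves := ((preserves_of_subset hU).trans
    (hL.preserves.anti Set.subset_union_left subset_rfl)).trans (preserves_diff_removed e C D U₂)
  covers K hK := by
    rcases (hK.preserved (preserves_of_subset hU)).left_or_right hI hC he hL with h | h
    · exact ((hL.covers K h).anti Set.subset_union_left).preserved
        (preserves_diff_removed e C D U₂)
    · obtain ⟨J, hJ⟩ := h.exists_isAlternative hC
      exact absurd hJ (hno J)

/-- The postcondition after the left and the right branch. -/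
theorem explored_of_right (hI : M.IsIndependence I) {N C D U U₁ U₂ U₃ G₂ G₃ G' : Set (Event T)}
    {s : S} {e : Event T} (hC : IsConfig M I C) (hU : U ⊆ U₁) (he : e ∈ enab M I C)
    (hL : Explored M I N s (C ∪ {e}) D U₁ U₂ G₂) (hR : Explored M I N s C (D ∪ {e}) U₂ U₃ G₃)
    (hG' : G' ⊆ G₃ ∪ removed M I e C D U₃) :
    Explored M I N s C D U (U₃ \ removed M I e C D U₃) G' where
  stored := Set.sdiff_subset.trans hR.stored
  discarded := discarded_of_remove hR.stored hR.discarded hG'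
  preserves := (((preserves_of_subset hU).trans
    (hL.preserves.anti Set.subset_union_left subset_rfl)).trans
    (hR.preserves.anti subset_rfl Set.subset_union_left)).trans (preserves_diff_removed e C D U₃)
  covers K hK := by
    refine Covers.preserved (D := D) ?_ (preserves_diff_removed e C D U₃)
    rcases (hK.preserved (preserves_of_subset hU)).left_or_right hI hC he hL with h | h
    · exact ((hL.covers K h).anti Set.subset_union_left).preserved
        (hR.preserves.anti subset_rfl Set.subset_union_left)
    · exact hR.covers K h

/-- The invariant at the left recursive call. -/
theorem Explorable.left {C D A U U' G G' : Set (Event T)} (h : Explorable M I C D A U G)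
    (hU : U ⊆ U') (hU' : U' ⊆ nonRepeating M I) (hG : G' ⊆ G) {e : Event T}
    (he : e ∈ enab M I C ∩ U') (hA : A = ∅ ∨ e ∈ A) :
    Explorable M I (C ∪ {e}) D (A \ {e}) U' G' := by
  have hsub : C ∪ A ⊆ C ∪ {e} ∪ A \ {e} := by
    rw [Set.union_assoc, Set.union_sdiff_self]
    exact Set.union_subset_union_right C Set.subset_union_right
  refine ⟨?_, Or.inl h.bot_mem, ?_, ?_, Set.sdiff_subset.trans (h.subset'.trans hU), ?_, ?_, hU',
    fun x hx => h.discarded x (hG hx)⟩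
  · rw [Set.union_singleton]; exact he.1.2
  · exact Set.union_subset (h.subset.trans hU) (Set.singleton_subset_iff.mpr he.2)
  · rcases hA with rfl | hA
    · rw [Set.empty_sdiff, Set.union_empty, Set.union_singleton]; exact he.1.2
    · rw [Set.union_assoc, Set.union_sdiff_self,
        Set.union_eq_right.mpr (Set.singleton_subset_iff.mpr hA)]
      exact h.isConfig_union
  · rintro x ⟨hx, hxe⟩ (hxC | hxe')
    exacts [h.notMem x hx hxC, hxe hxe']
  · intro d hd
    obtain ⟨e', he', hc⟩ := h.conflict d hd
    exact ⟨e', hsub he', hc⟩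

/-- The invariant at the right recursive call. -/
theorem IsAlternative.explorable {C D U G J : Set (Event T)} (hJ : IsAlternative M I U C D J)
    (hC : IsConfig M I C) (hbot : bot ∈ C) (hCU : C ⊆ U) (hU : U ⊆ nonRepeating M I)
    (hG : ∀ e ∈ G, IsEvent M I e) : Explorable M I C D (J \ C) U G where
  isConfig := hC
  bot_mem := hbot
  subset := hCU
  isConfig_union := by rw [Set.union_sdiff_self]; exact hJ.2.2.1
  subset' := Set.sdiff_subset.trans hJ.2.1
  notMem _ hx := hx.2
  conflict d hd := by
    obtain ⟨e, he, hde⟩ := hJ.2.2.2 d hd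
    exact ⟨e, by rwa [Set.union_sdiff_self], hde.1.1⟩
  stored := hU
  discarded := hG

/-- Needed for termination of the right calls. Each event of `D` conflicts with some event of `C ∪
A`, whereas the chosen event is compatible with `C ∪ A`. -/
theorem Explorable.notMem_of_choice {C D A U G : Set (Event T)} (h : Explorable M I C D A U G)
    {e : Event T} (he : e ∈ enab M I C) (hA : A = ∅ ∨ e ∈ A) : e ∉ D := by
  intro hD
  obtain ⟨e', he', hc⟩ := h.conflict e hD
  rcases hA with rfl | hA
  · rw [Set.union_empty] at he'
    exact he.2.not_conflict (Set.mem_insert _ _) (Set.mem_insert_of_mem _ he') hc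
  · exact h.isConfig_union.not_conflict (Or.inr hA) he' hc

/-- The algorithm never gets stuck on a nonempty `A`: a minimal event of `A` is enabled by `C`, and
it is stored. -/
theorem Explorable.exists_choice {C D A U U' G : Set (Event T)} (h : Explorable M I C D A U G)
    (hU : U ⊆ U') (hne : (enab M I C ∩ U').Nonempty) :
    ∃ e ∈ enab M I C ∩ U', A = ∅ ∨ e ∈ A := by
  rcases A.eq_empty_or_nonempty with hA | ⟨a, ha⟩
  · obtain ⟨e, he⟩ := hne
    exact ⟨e, he, Or.inl hA⟩
  · obtain ⟨m, hm, hmen⟩ := exists_mem_enab h.isConfig h.isConfig_union ha (h.notMem a ha)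
    exact ⟨m, ⟨hmen, hU (h.subset' hm)⟩, Or.inr hm⟩

/-! ### Termination and completeness -/

theorem ncard_sdiff_union_singleton_lt {α : Type*} {F X : Set α} (hF : F.Finite) {a : α}
    (ha : a ∈ F) (haX : a ∉ X) : (F \ (X ∪ {a})).ncard < (F \ X).ncard := by
  rw [← Set.sdiff_sdiff]
  exact Set.ncard_sdiff_singleton_lt_of_mem ⟨ha, haX⟩ (hF.subset Set.sdiff_subset)

theorem inevitable_remove {s : S} {e : Event T} {C D U G : Set (Event T)} {k : List (Task T)}
    (h : ∀ G' ⊆ G ∪ removed M I e C D U,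
      Inevitable (Step M I prec) (Witnesses M I s) ⟨U \ removed M I e C D U, G', k⟩) :
    Inevitable (Step M I prec) (Witnesses M I s) ⟨U, G, .remove e C D :: k⟩ := by
  refine .later ⟨_, .remove subset_rfl⟩ fun m' hm' => ?_
  cases hm' with
  | remove hG' => exact h _ hG'

/-- A call of `Explore` returns with the postcondition, unless a configuration that contains one
with state `s` is visited. -/
theorem inevitable_explore (hI : M.IsIndependence I) (hreach : M.reach.Finite)
    (hbranch : ∀ s ∈ M.reach, (M.enabled s).Finite) (hprec : IsAdequate M I prec) (s : S) (n : ℕ)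
    {C D A U G : Set (Event T)} {k : List (Task T)} (h : Explorable M I C D A U G)
    (hn : (nonRepeating M I \ C).ncard + (nonRepeating M I \ D).ncard < n)
    (hk : ∀ U' G', Explored M I (neverCutoff M I prec) s C D U U' G' →
      Inevitable (Step M I prec) (Witnesses M I s) ⟨U', G', k⟩) :
    Inevitable (Step M I prec) (Witnesses M I s) ⟨U, G, .explore C D A :: k⟩ := by
  have hfin := finite_nonRepeating hI hreach hbranch
  -- The stack `k` varies in the induction and `hk` acts as a continuation: the left call returns to
  -- a pending `alternative` task, the right call to a pending `remove` task.
  induction n generalizing C D A U G k with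
  | zero => exact absurd hn (Nat.not_lt_zero _)
  | succ n ih =>
  by_cases hw : Witnesses M I s ⟨U, G, .explore C D A :: k⟩
  · exact .now hw
  have hs : ∀ K ⊆ C, IsConfig M I K → ¬ HasState M K s := fun K hKC hK hKs =>
    hw ⟨C, D, A, k, rfl, h.isConfig, K, hKC, hK, hKs⟩
  obtain ⟨U₀, hU₀⟩ := exists_extend M I prec C U G
  refine .later ⟨_, .extend hU₀⟩ fun m₁ hm₁ => ?_
  cases hm₁ with
  | @extend _ _ _ _ _ U₁ G₁ _ hext =>
  have hU₁ := hext.subset_nonRepeating hI hprec h.subset h.stored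
  refine .later ?_ fun m₂ hm₂ => ?_
  · rcases (enab M I C ∩ U₁).eq_empty_or_nonempty with hleaf | hne
    · exact ⟨_, .leaf hleaf⟩
    · obtain ⟨e, he, hA⟩ := h.exists_choice hext.1 hne
      exact ⟨_, .left e he hA⟩
  cases hm₂ with
  | leaf hleaf => exact hk _ _ (explored_of_leaf h hs hext hU₁ hleaf)
  | left e he hA =>
  -- The chosen event lies in the finite set `nonRepeating M I` but neither in `C` nor in `D`, so
  -- both recursive calls decrease the measure.
  have heD := h.notMem_of_choice he.1 hA
  have heF := hU₁ he.2
  have hlt := ncard_sdiff_union_singleton_lt hfin heF he.1.1.2.1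
  have hlt' := ncard_sdiff_union_singleton_lt hfin heF heD
  refine ih (h.left hext.1 hU₁ hext.2.2.1 he hA) (by omega) fun U₂ G₂ hL => ?_
  have hCU₂ : C ⊆ U₂ := (hL.preserves.anti Set.subset_union_left subset_rfl).subset
    (h.subset.trans hext.1)
  refine .later ?_ fun m₃ hm₃ => ?_
  · by_cases halt : ∃ J, IsAlternative M I U₂ C (D ∪ {e}) J
    · obtain ⟨J, hJ⟩ := halt
      exact ⟨_, .right J hJ⟩
    · exact ⟨_, .noRight (not_exists.mp halt)⟩
  cases hm₃ with
  | noRight hno =>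
    exact inevitable_remove fun G' hG' =>
      hk _ _ (explored_of_noRight hI h.isConfig hext.1 he.1 hL hno hG')
  | right J hJ =>
    refine ih (hJ.explorable h.isConfig h.bot_mem hCU₂ hL.stored hL.discarded) (by omega)
      fun U₃ G₃ hR => inevitable_remove fun G' hG' =>
        hk _ _ (explored_of_right hI h.isConfig hext.1 he.1 hL hR hG')

theorem explorable_start : Explorable M I {bot} ∅ ∅ {bot} ∅ where
  isConfig := isConfig_singleton_bot
  bot_mem := rfl
  subset := subset_rfl
  isConfig_union := by rw [Set.union_empty]; exact isConfig_singleton_bot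
  subset' := Set.empty_subset _
  notMem := by simp
  conflict := by simp
  stored := Set.singleton_subset_iff.mpr bot_mem_nonRepeating
  discarded := by simp

end PartialOrderUnfolding

open PartialOrderUnfolding in
/-- The size order is adequate, and for every adequate order the exploration algorithm with the
cutoff check is complete: whatever its choices, for every reachable state `s` it explores a
configuration with a subconfiguration that reaches `s`. -/
theorem theorem5 {S : Type v} {T : Type u} (M : System S T) (I : T → T → Prop)
    (hI : M.IsIndependence I) (hreach : M.reach.Finite)
    (hbranch : ∀ s ∈ M.reach, (M.enabled s).Finite) :
    IsAdequate M I sizeOrder ∧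
    ∀ prec : Set (Event T) → Set (Event T) → Prop, IsAdequate M I prec →
      ∀ s ∈ M.reach, Inevitable (Step M I prec) (Witnesses M I s) Machine.start := by
  refine ⟨isAdequate_sizeOrder, fun prec hprec s hs => ?_⟩
  refine inevitable_explore hI hreach hbranch hprec s _ explorable_start (Nat.lt_succ_self _)
    fun U' G' h => ?_
  obtain ⟨K, hK, hKs, hKN⟩ := hprec.exists_config_subset_neverCutoff hI hs
  -- With `D` empty the conflict condition on targets is vacuous. `K` would lie in a visited
  -- configuration said to contain no configuration with state `s`.
  obtain ⟨C', hKC', hC', -⟩ := h.covers K ⟨hK, by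
    rw [Set.singleton_union]; exact hK.insert_bot hI, hKN, by simp⟩
  exact absurd hKs (hC' K hKC' hK)
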